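/- Let $G$ be a Lie group acting smoothly, properly and isometrically on a complete Riemannian manifold $M$ (smooth, without boundary, Hausdorff and second countable), and suppose that the orbit space $M/G$ is connected (for instance, that $M$ is connected) and not compact. Call $K\subseteq M$ cocompact if its image in $M/G$ has compact closure. Let $C_g^{\infty,G}(M)$ be the algebra of bounded smooth $G$-invariant functions $f\colon M\to\mathbb{C}$ such that for every $\epsilon>0$ there is a cocompact set $K\subseteq M$ with $\|df\|_{T^*M}<\epsilon$ on $M\setminus K$. Let $C_g^G(M)$ be its closure, with respect to the supremum norm, in the algebra of bounded continuous functions on $M$, and let the Higson $G$-compactification $\overline{M}^G$ be the maximal ideal space of the commutative $C^*$-algebra $C_g^G(M)$. Then the first Čech cohomology group with integer coefficients $\check H^1(\overline{M}^G)=\check H^1(\overline{M}^G;\mathbb{Z})$ contains a subgroup isomorphic to $(\mathbb{R},+)$. -/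

import Mathlib

open scoped Manifold ContDiff Bundle BoundedContinuousFunction
open TopologicalSpace Bundle

noncomputable section

/-! ## First Čech cohomology with integer coefficients -/

namespace Cech

/-- An open cover of `X`, given as a family `(U x)` of open sets indexed by the points of `X` with
`x ∈ U x`. Every open cover is refined by one of this form. -/
structure Cover (X : Type*) [TopologicalSpace X] where
  U : X → Set X
  isOpen : ∀ x, IsOpen (U x)
  mem : ∀ x, x ∈ U x

variable {X : Type*} [TopologicalSpace X]

/-- Covers are ordered by refinement; finer covers are larger. -/
instance : Preorder (Cover X) where
  le 𝒰 𝒱 := ∀ x, 𝒱.U x ⊆ 𝒰.U x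
  le_refl _ _ := subset_rfl
  le_trans _ _ _ h₁ h₂ x := (h₂ x).trans (h₁ x)

instance : Nonempty (Cover X) :=
  ⟨⟨fun _ => Set.univ, fun _ => isOpen_univ, fun _ => trivial⟩⟩

instance : IsDirectedOrder (Cover X) where
  directed 𝒰 𝒱 :=
    ⟨⟨fun x => 𝒰.U x ∩ 𝒱.U x, fun x => (𝒰.isOpen x).inter (𝒱.isOpen x),
      fun x => ⟨𝒰.mem x, 𝒱.mem x⟩⟩,
      fun _ => Set.inter_subset_left, fun _ => Set.inter_subset_right⟩

/-- The ordered 1-simplices of the nerve of the cover. -/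
def Edge (𝒰 : Cover X) : Type _ :=
  {p : X × X // (𝒰.U p.1 ∩ 𝒰.U p.2).Nonempty}

/-- The ordered 2-simplices of the nerve of the cover. -/
def Triangle (𝒰 : Cover X) : Type _ :=
  {p : X × X × X // (𝒰.U p.1 ∩ 𝒰.U p.2.1 ∩ 𝒰.U p.2.2).Nonempty}

/-- The face `[x₁, x₂]` of `[x₀, x₁, x₂]`. -/
def Triangle.face₀ {𝒰 : Cover X} (t : Triangle 𝒰) : Edge 𝒰 :=
  ⟨(t.1.2.1, t.1.2.2), t.2.mono fun _ h => ⟨h.1.2, h.2⟩⟩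

/-- The face `[x₀, x₂]` of `[x₀, x₁, x₂]`. -/
def Triangle.face₁ {𝒰 : Cover X} (t : Triangle 𝒰) : Edge 𝒰 :=
  ⟨(t.1.1, t.1.2.2), t.2.mono fun _ h => ⟨h.1.1, h.2⟩⟩

/-- The face `[x₀, x₁]` of `[x₀, x₁, x₂]`. -/
def Triangle.face₂ {𝒰 : Cover X} (t : Triangle 𝒰) : Edge 𝒰 :=
  ⟨(t.1.1, t.1.2.1), t.2.mono fun _ h => h.1⟩

/-- The Čech differential from integral 0-cochains to 1-cochains of the nerve
(every `U x` is non-empty, so the vertices of the nerve are the points of `X`). -/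
def d₀ (𝒰 : Cover X) : (X → ℤ) →+ (Edge 𝒰 → ℤ) where
  toFun b e := b e.1.2 - b e.1.1
  map_zero' := by ext; simp
  map_add' b b' := by ext; simp only [Pi.add_apply]; ring

/-- The Čech differential from integral 1-cochains to 2-cochains of the nerve. -/
def d₁ (𝒰 : Cover X) : (Edge 𝒰 → ℤ) →+ (Triangle 𝒰 → ℤ) where
  toFun c t := c t.face₀ - c t.face₁ + c t.face₂
  map_zero' := by ext; simp
  map_add' c c' := by ext; simp only [Pi.add_apply]; ring

theorem d₁_d₀ (𝒰 : Cover X) (b : X → ℤ) : d₁ 𝒰 (d₀ 𝒰 b) = 0 := by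
  ext t
  simp [d₁, d₀, Triangle.face₀, Triangle.face₁, Triangle.face₂]

/-- 1-cocycles. -/
abbrev Z1 (𝒰 : Cover X) : AddSubgroup (Edge 𝒰 → ℤ) := (d₁ 𝒰).ker

/-- 1-coboundaries, as a subgroup of the 1-cocycles. -/
abbrev B1 (𝒰 : Cover X) : AddSubgroup (Z1 𝒰) := (d₀ 𝒰).range.addSubgroupOf (Z1 𝒰)

/-- The first integral cohomology of the nerve of a cover. -/
abbrev H1Cover (𝒰 : Cover X) : Type _ := Z1 𝒰 ⧸ B1 𝒰

/-- Restriction of 1-cochains to a finer cover. -/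
def resCochain {𝒰 𝒱 : Cover X} (h : 𝒰 ≤ 𝒱) : (Edge 𝒰 → ℤ) →+ (Edge 𝒱 → ℤ) where
  toFun c e := c ⟨e.1, e.2.mono (Set.inter_subset_inter (h _) (h _))⟩
  map_zero' := rfl
  map_add' _ _ := rfl

/-- Restriction of 1-cocycles to a finer cover. -/
def resCocycle {𝒰 𝒱 : Cover X} (h : 𝒰 ≤ 𝒱) : Z1 𝒰 →+ Z1 𝒱 :=
  ((resCochain h).comp (Z1 𝒰).subtype).codRestrict (Z1 𝒱) fun c => by
    ext t
    exact congrFun c.2 ⟨t.1, t.2.mono (Set.inter_subset_inter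
      (Set.inter_subset_inter (h _) (h _)) (h _))⟩

/-- Restriction of cohomology classes to a finer cover. -/
def res (𝒰 𝒱 : Cover X) (h : 𝒰 ≤ 𝒱) : H1Cover 𝒰 →+ H1Cover 𝒱 :=
  QuotientAddGroup.map (B1 𝒰) (B1 𝒱) (resCocycle h) (by
    rintro ⟨c, hc⟩ ⟨b, hb⟩
    exact ⟨b, congrArg (resCochain h) hb⟩)

open Classical in
/-- The first Čech cohomology group `Ȟ¹(X; ℤ)`: the direct limit, over all open covers ordered by
refinement, of the first cohomology of the nerve. -/
abbrev H1 (X : Type*) [TopologicalSpace X] : Type _ :=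
  AddCommGroup.DirectLimit (fun 𝒰 : Cover X => H1Cover 𝒰) res

end Cech

/-! ## The Higson `G`-compactification -/

namespace Higson

/-- A subset of `M` is cocompact if its image in `M/G` has compact closure. -/
def IsCocompact (G : Type*) {M : Type*} [Group G] [TopologicalSpace M] [MulAction G M]
    (K : Set M) : Prop :=
  IsCompact (closure ((Quotient.mk (MulAction.orbitRel G M) : M → MulAction.orbitRel.Quotient G M)
    '' K))

theorem IsCocompact.union {G M : Type*} [Group G] [TopologicalSpace M] [MulAction G M]
    {K L : Set M} (hK : IsCocompact G K) (hL : IsCocompact G L) : IsCocompact G (K ∪ L) := by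
  unfold IsCocompact at *
  rw [Set.image_union, closure_union]
  exact hK.union hL

theorem isCocompact_empty {G M : Type*} [Group G] [TopologicalSpace M] [MulAction G M] :
    IsCocompact G (∅ : Set M) := by
  simp [IsCocompact]

variable {E : Type*} [NormedAddCommGroup E] [NormedSpace ℝ E]
  {M : Type*} [TopologicalSpace M] [ChartedSpace E M]
  [RiemannianBundle (fun x : M => TangentSpace 𝓘(ℝ, E) x)]

variable (E) in
/-- The differential of a complex-valued function at `x`, as a real-linear form on the tangent
space at `x`. -/
def differential (f : M → ℂ) (x : M) : TangentSpace 𝓘(ℝ, E) x →L[ℝ] ℂ :=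
  mfderiv 𝓘(ℝ, E) 𝓘(ℝ, ℂ) f x

variable (E) in
/-- The norm of the differential `df` at `x`, with respect to the Riemannian metric. -/
def normDiff (f : M → ℂ) (x : M) : ℝ := ‖differential E f x‖

variable (E) in
/-- `‖df‖` tends to `0` at infinity transversally to the orbits: for every `ε > 0`, it is smaller
than `ε` outside some cocompact set. -/
def DiffVanishes (G : Type*) [Group G] [MulAction G M] (f : M → ℂ) : Prop :=
  ∀ ε > 0, ∃ K : Set M, IsCocompact G K ∧ ∀ x ∉ K, normDiff E f x < ε

theorem le_normDiff (f : M → ℂ) (x : M) (v : TangentSpace 𝓘(ℝ, E) x) :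
    ‖differential E f x v‖ ≤ normDiff E f x * ‖v‖ :=
  (differential E f x).le_opNorm v

theorem normDiff_nonneg (f : M → ℂ) (x : M) : 0 ≤ normDiff E f x :=
  norm_nonneg (differential E f x)

theorem normDiff_le {f : M → ℂ} {x : M} {C : ℝ} (hC : 0 ≤ C)
    (h : ∀ v, ‖differential E f x v‖ ≤ C * ‖v‖) : normDiff E f x ≤ C :=
  (differential E f x).opNorm_le_bound hC h

theorem normDiff_const (c : ℂ) (x : M) : normDiff E (fun _ : M => c) x = 0 := by
  have h : differential E (fun _ : M => c) x = 0 := mfderiv_const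
  refine le_antisymm (normDiff_le le_rfl fun v => ?_) (normDiff_nonneg _ x)
  rw [h]
  simp

theorem normDiff_add_le {f g : M → ℂ} {x : M} (hf : MDifferentiableAt 𝓘(ℝ, E) 𝓘(ℝ, ℂ) f x)
    (hg : MDifferentiableAt 𝓘(ℝ, E) 𝓘(ℝ, ℂ) g x) :
    normDiff E (f + g) x ≤ normDiff E f x + normDiff E g x := by
  have h : differential E (f + g) x = differential E f x + differential E g x :=
    mfderiv_add hf hg
  refine normDiff_le (add_nonneg (normDiff_nonneg f x) (normDiff_nonneg g x)) fun v => ?_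
  rw [h, add_mul]
  exact (norm_add_le (differential E f x v) (differential E g x v)).trans
    (add_le_add (le_normDiff f x v) (le_normDiff g x v))

theorem normDiff_mul_le {f g : M → ℂ} {x : M} (hf : MDifferentiableAt 𝓘(ℝ, E) 𝓘(ℝ, ℂ) f x)
    (hg : MDifferentiableAt 𝓘(ℝ, E) 𝓘(ℝ, ℂ) g x) :
    normDiff E (f * g) x ≤ ‖f x‖ * normDiff E g x + ‖g x‖ * normDiff E f x := by
  have h : ∀ v, differential E (f * g) x v =
      f x * differential E g x v + g x * differential E f x v :=
    fun v => DFunLike.congr_fun (hf.hasMFDerivAt.mul hg.hasMFDerivAt).mfderiv v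
  have := normDiff_nonneg (E := E) f x
  have := normDiff_nonneg (E := E) g x
  refine normDiff_le (by positivity) fun v => ?_
  rw [h, add_mul, mul_assoc, mul_assoc]
  refine (norm_add_le _ _).trans ?_
  rw [norm_mul, norm_mul]
  gcongr
  · exact le_normDiff g x v
  · exact le_normDiff f x v

theorem normDiff_star_le {f : M → ℂ} {x : M} (hf : MDifferentiableAt 𝓘(ℝ, E) 𝓘(ℝ, ℂ) f x) :
    normDiff E (star f) x ≤ normDiff E f x := by
  have h : ∀ v, differential E (star f) x v = Complex.conjCLE (differential E f x v) :=
    fun v => DFunLike.congr_fun (HasMFDerivAt.comp x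
      (Complex.conjCLE.toContinuousLinearMap.hasMFDerivAt (x := f x)) hf.hasMFDerivAt).mfderiv v
  refine normDiff_le (normDiff_nonneg f x) fun v => ?_
  rw [h]
  exact (Complex.norm_conj _).trans_le (le_normDiff f x v)

variable (E) in
/-- The algebra of bounded smooth `G`-invariant functions `f` whose differential vanishes at
infinity transversally to the orbits. -/
def smoothAlgebra (G : Type*) (M : Type*) [TopologicalSpace M] [ChartedSpace E M]
    [RiemannianBundle (fun x : M => TangentSpace 𝓘(ℝ, E) x)] [Group G] [MulAction G M] :
    StarSubalgebra ℂ (M →ᵇ ℂ) where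
  carrier := {f | (∀ (g : G) (x : M), f (g • x) = f x) ∧ ContMDiff 𝓘(ℝ, E) 𝓘(ℝ, ℂ) ∞ f ∧
    DiffVanishes E G f}
  mul_mem' := by
    rintro f₁ f₂ ⟨hi₁, hs₁, hv₁⟩ ⟨hi₂, hs₂, hv₂⟩
    refine ⟨fun g x => by simp [hi₁ g x, hi₂ g x], contDiff_mul.contMDiff.comp (hs₁.prodMk_space hs₂), fun ε hε => ?_⟩
    set C := ‖f₁‖ + ‖f₂‖ + 1 with hC
    have hCpos : 0 < C := by positivity
    obtain ⟨K₁, hK₁, h₁⟩ := hv₁ (ε / C) (by positivity)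
    obtain ⟨K₂, hK₂, h₂⟩ := hv₂ (ε / C) (by positivity)
    refine ⟨K₁ ∪ K₂, hK₁.union hK₂, fun x hx => ?_⟩
    rw [Set.mem_union, not_or] at hx
    calc normDiff E (f₁ * f₂ : M → ℂ) x
        ≤ ‖f₁ x‖ * normDiff E f₂ x + ‖f₂ x‖ * normDiff E f₁ x :=
          normDiff_mul_le (hs₁.mdifferentiable (by simp) x) (hs₂.mdifferentiable (by simp) x)
      _ ≤ ‖f₁‖ * (ε / C) + ‖f₂‖ * (ε / C) := by
          have := normDiff_nonneg (E := E) f₁ x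
          have := normDiff_nonneg (E := E) f₂ x
          gcongr
          · exact f₁.norm_coe_le_norm x
          · exact (h₂ x hx.2).le
          · exact f₂.norm_coe_le_norm x
          · exact (h₁ x hx.1).le
      _ < C * (ε / C) := by
          have : 0 < ε / C := by positivity
          rw [hC] at this ⊢
          nlinarith
      _ = ε := by field_simp
  add_mem' := by
    rintro f₁ f₂ ⟨hi₁, hs₁, hv₁⟩ ⟨hi₂, hs₂, hv₂⟩
    refine ⟨fun g x => by simp [hi₁ g x, hi₂ g x], hs₁.add hs₂, fun ε hε => ?_⟩
    obtain ⟨K₁, hK₁, h₁⟩ := hv₁ (ε / 2) (by positivity)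
    obtain ⟨K₂, hK₂, h₂⟩ := hv₂ (ε / 2) (by positivity)
    refine ⟨K₁ ∪ K₂, hK₁.union hK₂, fun x hx => ?_⟩
    rw [Set.mem_union, not_or] at hx
    calc normDiff E (f₁ + f₂ : M → ℂ) x
        ≤ normDiff E f₁ x + normDiff E f₂ x :=
          normDiff_add_le (hs₁.mdifferentiable (by simp) x) (hs₂.mdifferentiable (by simp) x)
      _ < ε / 2 + ε / 2 := add_lt_add (h₁ x hx.1) (h₂ x hx.2)
      _ = ε := add_halves ε
  algebraMap_mem' c :=
    ⟨fun _ _ => rfl, contMDiff_const, fun ε hε => ⟨∅, isCocompact_empty, fun x _ =>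
      (normDiff_const (E := E) c x).trans_lt hε⟩⟩
  star_mem' := by
    rintro f ⟨hi, hs, hv⟩
    refine ⟨fun g x => by simp [hi g x],
      Complex.conjCLE.contDiff.contMDiff.comp hs, fun ε hε => ?_⟩
    obtain ⟨K, hK, h⟩ := hv ε hε
    exact ⟨K, hK, fun x hx =>
      (normDiff_star_le (hs.mdifferentiable (by simp) x)).trans_lt (h x hx)⟩

variable (E) in
/-- The `C⋆`-algebra `C_g^G(M)`: the closure of the smooth algebra in the sup norm. -/
abbrev algebra (G : Type*) (M : Type*) [TopologicalSpace M] [ChartedSpace E M]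
    [RiemannianBundle (fun x : M => TangentSpace 𝓘(ℝ, E) x)] [Group G] [MulAction G M] :
    StarSubalgebra ℂ (M →ᵇ ℂ) :=
  (smoothAlgebra E G M).topologicalClosure

variable (E) in
/-- The Higson `G`-compactification: the maximal ideal space of the commutative `C⋆`-algebra
`C_g^G(M)`, that is its space of characters with the weak-⋆ topology. -/
abbrev Compactification (G : Type*) (M : Type*) [TopologicalSpace M] [ChartedSpace E M]
    [RiemannianBundle (fun x : M => TangentSpace 𝓘(ℝ, E) x)] [Group G] [MulAction G M] : Type _ :=
  WeakDual.characterSpace ℂ (algebra E G M)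

end Higson

end

/-! Suppose `h : M → ℝ` is smooth, invariant and unbounded above, with `dh` tending to zero
transversally to the orbits. For every real `t` the function `exp (2πi t h)` then lies in the
algebra, although `t h` itself does not when `t ≠ 0`. A character sends this unitary to a unit
complex number, so it defines a continuous map from the compactification to the circle, additively
in `t`.

Circle-valued maps have a winding class in the first Čech group, and this class vanishes only if the
map lifts to a continuous real function (`exists_lift_of_windingHom_eq_zero`). If the map attached
to `t` had a lift `θ`, then `t h - θ` would be integer-valued, continuous and invariant on `M`,
hence constant because the orbit space is connected. But `θ` is bounded, since the compactification
is compact, and `h` is not, so `t = 0`. Thus `ℝ` embeds (`phaseHom_injective`).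

To construct `h`, let `f` be the distance to one orbit. It is finite because the orbit space is
connected, and it is invariant and 1-Lipschitz. By Hopf–Rinow its sublevel sets are cocompact, so it
is unbounded (`exists_invariant_lipschitz_exhaustion`). Since `f` need not be smooth, it is
mollified in charts of uniformly bounded distortion; the pieces are added and averaged over `G` with
Haar measure (`exists_invariant_smoothing`). This gives smooth invariant functions near `f`, with
differential at most 5, each on a set containing a prescribed sublevel set. Cutting them off yields
steps `χ n` that rise from 0 to 1 between the levels `n` and `n + 1` of `f`, with a differential
bound independent of `n`. Then `h = ∑ χ n / (n + 1)` works: its differential is of order `1 / f`,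
and it is unbounded because the harmonic series diverges. -/

noncomputable section

/-! ### The winding class of a circle-valued map. -/

namespace Cech

variable {X : Type*} [TopologicalSpace X]

instance : DirectedSystem (fun 𝒰 : Cover X => H1Cover 𝒰) fun 𝒰 𝒱 h => res 𝒰 𝒱 h where
  map_self 𝒰 c := by
    induction c using QuotientAddGroup.induction_on with
    | H c => rfl
  map_map 𝒰 𝒱 𝒲 h₁ h₂ c := by
    induction c using QuotientAddGroup.induction_on with
    | H c => rfl

/-- A (discontinuous) real lift of a circle-valued map. -/
def realLift (α : C(X, UnitAddCircle)) (x : X) : ℝ :=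
  (QuotientAddGroup.mk_surjective (α x)).choose

@[simp]
theorem coe_realLift (α : C(X, UnitAddCircle)) (x : X) :
    ((realLift α x : ℝ) : UnitAddCircle) = α x :=
  (QuotientAddGroup.mk_surjective (α x)).choose_spec

/-- The cover of `X` on each member of which the circle-valued map `α` is almost constant. -/
def circleCover (α : C(X, UnitAddCircle)) : Cover X where
  U x := {p | ‖α p - α x‖ < 1 / 8}
  isOpen x := isOpen_lt (by fun_prop) continuous_const
  mem x := by simp

theorem norm_sub_lt_of_edge (α : C(X, UnitAddCircle)) {x y : X}
    (h : ((circleCover α).U x ∩ (circleCover α).U y).Nonempty) : ‖α y - α x‖ < 1 / 4 := by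
  obtain ⟨p, hx, hy⟩ := h
  have hx : ‖α p - α x‖ < 1 / 8 := hx
  have hy : ‖α p - α y‖ < 1 / 8 := hy
  calc ‖α y - α x‖ = ‖(α p - α x) - (α p - α y)‖ := by congr 1; abel
    _ ≤ ‖α p - α x‖ + ‖α p - α y‖ := norm_sub_le _ _
    _ < 1 / 4 := by linarith

theorem norm_sub_eq_abs (α : C(X, UnitAddCircle)) (x y : X) :
    ‖α y - α x‖ =
      |(realLift α y - realLift α x) - round (realLift α y - realLift α x)| := by
  rw [← UnitAddCircle.norm_eq, AddCircle.coe_sub, coe_realLift, coe_realLift]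

theorem abs_sub_round_lt_of_edge (α : C(X, UnitAddCircle)) {x y : X}
    (h : ((circleCover α).U x ∩ (circleCover α).U y).Nonempty) :
    |(realLift α y - realLift α x) - round (realLift α y - realLift α x)| < 1 / 4 :=
  norm_sub_eq_abs α x y ▸ norm_sub_lt_of_edge α h

/-- The winding cocycle of a circle-valued map. -/
def windingCocycle (α : C(X, UnitAddCircle)) : Z1 (circleCover α) :=
  ⟨fun e => round (realLift α e.1.2 - realLift α e.1.1), by
    ext t
    have h₀ := abs_lt.1 (abs_sub_round_lt_of_edge α t.face₀.2)
    have h₁ := abs_lt.1 (abs_sub_round_lt_of_edge α t.face₁.2)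
    have h₂ := abs_lt.1 (abs_sub_round_lt_of_edge α t.face₂.2)
    have key : ∀ {a b c : ℝ} {i j k : ℤ}, -(1 / 4) < c - b - i ∧ c - b - i < 1 / 4 →
        -(1 / 4) < c - a - j ∧ c - a - j < 1 / 4 → -(1 / 4) < b - a - k ∧ b - a - k < 1 / 4 →
        -- The differences of the real lifts cancel around a triangle, so this integer is a signed
        -- sum of three rounding errors below 1/4, hence of absolute value below 1.
        i - j + k = 0 := by
      intro a b c i j k h₀ h₁ h₂
      have hu : ((i - j + k : ℤ) : ℝ) < 1 := by push_cast; linarith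
      have hl : (-1 : ℝ) < ((i - j + k : ℤ) : ℝ) := by push_cast; linarith
      have hu' : i - j + k < 1 := by exact_mod_cast hu
      have hl' : -1 < i - j + k := by exact_mod_cast hl
      omega
    exact key h₀ h₁ h₂⟩

open Classical in
/-- The Čech class of a circle-valued map. -/
def windingClass (α : C(X, UnitAddCircle)) : H1 X :=
  AddCommGroup.DirectLimit.of (fun 𝒰 : Cover X => H1Cover 𝒰) res (circleCover α)
    (QuotientAddGroup.mk (windingCocycle α))

open Classical in
theorem windingClass_eq_of_le (α : C(X, UnitAddCircle)) {𝒱 : Cover X} (h : circleCover α ≤ 𝒱) :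
    windingClass α = AddCommGroup.DirectLimit.of (fun 𝒰 : Cover X => H1Cover 𝒰) res 𝒱
      (QuotientAddGroup.mk (resCocycle h (windingCocycle α))) :=
  (AddCommGroup.DirectLimit.of_f (f := res) h
    (QuotientAddGroup.mk (windingCocycle α) : H1Cover (circleCover α))).symm

theorem exists_int_realLift_add (α β : C(X, UnitAddCircle)) (x : X) :
    ∃ n : ℤ, realLift (α + β) x - (realLift α x + realLift β x) = n := by
  have h : ((realLift (α + β) x - (realLift α x + realLift β x) : ℝ) : UnitAddCircle) = 0 := by
    rw [AddCircle.coe_sub, AddCircle.coe_add]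
    simp
  obtain ⟨n, hn⟩ := (AddCircle.coe_eq_zero_iff 1).1 h
  exact ⟨n, by rw [← hn]; simp⟩

/-- The chosen lifts need not be additive, but their defect is an integer-valued function `b` of the
point. On a common refinement, `b` is a 0-cochain whose coboundary is the difference of the two
cocycles. -/
theorem windingClass_add (α β : C(X, UnitAddCircle)) :
    windingClass (α + β) = windingClass α + windingClass β := by
  classical
  obtain ⟨𝒲, h₁, h₂⟩ := exists_ge_ge (circleCover α) (circleCover β)
  obtain ⟨𝒱, h₃, h₄⟩ := exists_ge_ge 𝒲 (circleCover (α + β))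
  have hα := h₁.trans h₃
  have hβ := h₂.trans h₃
  rw [windingClass_eq_of_le α hα, windingClass_eq_of_le β hβ, windingClass_eq_of_le (α + β) h₄,
    ← map_add, ← QuotientAddGroup.mk_add]
  congr 1
  symm
  rw [QuotientAddGroup.eq]
  choose b hb using exists_int_realLift_add α β
  refine ⟨b, ?_⟩
  ext e
  have hs := abs_lt.1 (abs_sub_round_lt_of_edge (α + β) (x := e.1.1) (y := e.1.2)
    (e.2.mono (Set.inter_subset_inter (h₄ _) (h₄ _))))
  have ha := abs_lt.1 (abs_sub_round_lt_of_edge α (x := e.1.1) (y := e.1.2)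
    (e.2.mono (Set.inter_subset_inter (hα _) (hα _))))
  have hb' := abs_lt.1 (abs_sub_round_lt_of_edge β (x := e.1.1) (y := e.1.2)
    (e.2.mono (Set.inter_subset_inter (hβ _) (hβ _))))
  change b e.1.2 - b e.1.1 =
    -(round (realLift α e.1.2 - realLift α e.1.1) + round (realLift β e.1.2 - realLift β e.1.1)) +
      round (realLift (α + β) e.1.2 - realLift (α + β) e.1.1)
  have h1 := hb e.1.1
  have h2 := hb e.1.2
  generalize round (realLift α e.1.2 - realLift α e.1.1) = i at *
  generalize round (realLift β e.1.2 - realLift β e.1.1) = j at *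
  generalize round (realLift (α + β) e.1.2 - realLift (α + β) e.1.1) = k at *
  -- Again an integer equal to a signed sum of three rounding errors, each below 1/4.
  have hu : ((b e.1.2 - b e.1.1 - (-(i + j) + k) : ℤ) : ℝ) < 1 := by push_cast; linarith
  have hl : (-1 : ℝ) < ((b e.1.2 - b e.1.1 - (-(i + j) + k) : ℤ) : ℝ) := by push_cast; linarith
  have hu' : b e.1.2 - b e.1.1 - (-(i + j) + k) < 1 := by exact_mod_cast hu
  have hl' : -1 < b e.1.2 - b e.1.1 - (-(i + j) + k) := by exact_mod_cast hl
  omega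

variable (X) in
/-- The homomorphism from circle-valued maps to the first Čech cohomology group. -/
def windingHom : C(X, UnitAddCircle) →+ H1 X :=
  AddMonoidHom.mk' windingClass windingClass_add

/-- A circle-valued map with trivial Čech class lifts to a continuous real function. -/
theorem exists_lift_of_windingHom_eq_zero {α : C(X, UnitAddCircle)} (h : windingHom X α = 0) :
    ∃ θ : C(X, ℝ), ∀ x, ((θ x : ℝ) : UnitAddCircle) = α x := by
  classical
  -- A class that dies in the direct limit is already a coboundary on some finer cover; the cochain
  -- `b` bounding it there corrects the discontinuous lift by integers.
  obtain ⟨𝒱, hle, h0⟩ := AddCommGroup.DirectLimit.of.zero_exact (f := res) _ _ h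
  have h0 : (QuotientAddGroup.mk (resCocycle hle (windingCocycle α)) : H1Cover 𝒱) = 0 := h0
  rw [QuotientAddGroup.eq_zero_iff] at h0
  obtain ⟨b, hb⟩ := h0
  have hb : ∀ x y, (𝒱.U x ∩ 𝒱.U y).Nonempty →
      b y - b x = round (realLift α y - realLift α x) := fun x y hxy =>
    congrFun hb (⟨(x, y), hxy⟩ : Edge 𝒱)
  have hcont : Continuous fun x => realLift α x - b x := by
    rw [continuous_iff_continuousAt]
    intro x
    rw [Metric.continuousAt_iff']
    intro ε hε
    have h1 : ∀ᶠ p in nhds x, ‖α p - α x‖ < ε := by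
      have : Continuous fun p => ‖α p - α x‖ := by fun_prop
      exact this.continuousAt.eventually_lt continuousAt_const (by simpa using hε)
    filter_upwards [h1, (𝒱.isOpen x).mem_nhds (𝒱.mem x)] with p hp hpV
    -- For `p` in `𝒱.U x`, the corrected lift changes from `x` to `p` by a lift difference minus its
    -- nearest integer, whose absolute value is exactly `‖α p - α x‖`.
    have := hb x p ⟨p, hpV, 𝒱.mem p⟩
    rw [norm_sub_eq_abs, ← this] at hp
    rw [Real.dist_eq]
    convert hp using 2
    push_cast
    ring
  refine ⟨⟨_, hcont⟩, fun x => ?_⟩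
  have h1 : ((b x : ℝ) : UnitAddCircle) = 0 :=
    (AddCircle.coe_eq_zero_iff 1).2 ⟨b x, by simp⟩
  simp [h1]

end Cech
end

/-! ### Phases of a slowly varying function and the embedding of the reals. -/

noncomputable section

namespace Higson

variable {E : Type*} [NormedAddCommGroup E] [NormedSpace ℝ E]
  {M : Type*} [TopologicalSpace M] [ChartedSpace E M]

variable {V : Type*} [NormedAddCommGroup V] [NormedSpace ℝ V]

variable (E) in
/-- The differential of a vector-valued function at `x`. -/
def vdiff (f : M → V) (x : M) : TangentSpace 𝓘(ℝ, E) x →L[ℝ] V :=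
  mfderiv 𝓘(ℝ, E) 𝓘(ℝ, V) f x

theorem hasMFDerivAt_vdiff {f : M → V} {x : M} (hf : MDifferentiableAt 𝓘(ℝ, E) 𝓘(ℝ, V) f x) :
    HasMFDerivAt 𝓘(ℝ, E) 𝓘(ℝ, V) f x (vdiff E f x) :=
  hf.hasMFDerivAt

theorem vdiff_eq_of_hasMFDerivAt {f : M → V} {x : M} {L : TangentSpace 𝓘(ℝ, E) x →L[ℝ] V}
    (hf : HasMFDerivAt 𝓘(ℝ, E) 𝓘(ℝ, V) f x L) : vdiff E f x = L :=
  hf.mfderiv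

/-- The phase `exp (2 π i t s)`. -/
def phase (t s : ℝ) : ℂ := Complex.exp ((2 * Real.pi * t * s : ℝ) * Complex.I)

theorem norm_phase (t s : ℝ) : ‖phase t s‖ = 1 := Complex.norm_exp_ofReal_mul_I _

theorem phase_add (s t r : ℝ) : phase (s + t) r = phase s r * phase t r := by
  rw [phase, phase, phase, ← Complex.exp_add]
  congr 1
  push_cast
  ring

theorem phase_zero (r : ℝ) : phase 0 r = 1 := by simp [phase]

theorem toCircle_coe_eq_phase (t s : ℝ) :
    ((AddCircle.toCircle ((t * s : ℝ) : UnitAddCircle) : Circle) : ℂ) = phase t s := by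
  rw [AddCircle.toCircle_apply_mk, Circle.coe_exp, phase]
  congr 3
  ring

theorem contDiff_phase (t : ℝ) : ContDiff ℝ ∞ (phase t) := by
  unfold phase
  have : ContDiff ℝ ∞ fun s : ℝ => ((2 * Real.pi * t * s : ℝ) : ℂ) :=
    Complex.ofRealCLM.contDiff.comp (contDiff_const.mul contDiff_id)
  fun_prop

theorem hasDerivAt_phase (t s : ℝ) :
    HasDerivAt (phase t) (phase t s * ((2 * Real.pi * t : ℝ) * Complex.I)) s := by
  have h1 : HasDerivAt (fun s : ℝ => ((2 * Real.pi * t * s : ℝ) : ℂ))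
      ((2 * Real.pi * t : ℝ) : ℂ) s := by
    have : HasDerivAt (fun s : ℝ => 2 * Real.pi * t * s) (2 * Real.pi * t) s := by
      simpa using (hasDerivAt_id s).const_mul (2 * Real.pi * t)
    exact this.ofReal_comp
  exact (h1.mul_const Complex.I).cexp

variable [RiemannianBundle (fun x : M => TangentSpace 𝓘(ℝ, E) x)]

theorem normDiff_phase_le {h : M → ℝ} {x : M} (t : ℝ) {C : ℝ} (hC : 0 ≤ C)
    (hh : MDifferentiableAt 𝓘(ℝ, E) 𝓘(ℝ, ℝ) h x)
    (hb : ∀ v, |vdiff E h x v| ≤ C * ‖v‖) :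
    normDiff E (fun x => phase t (h x)) x ≤ |2 * Real.pi * t| * C := by
  refine normDiff_le (by positivity) fun v => ?_
  have h1 : HasMFDerivAt 𝓘(ℝ, E) 𝓘(ℝ, ℂ) (phase t ∘ h) x _ :=
    HasMFDerivAt.comp x (hasDerivAt_phase t (h x)).hasFDerivAt.hasMFDerivAt (hasMFDerivAt_vdiff hh)
  have h2 : differential E (fun x => phase t (h x)) x v =
      vdiff E h x v • (phase t (h x) * ((2 * Real.pi * t : ℝ) * Complex.I)) :=
    DFunLike.congr_fun h1.mfderiv v
  rw [h2, norm_smul, norm_mul, norm_phase, norm_mul, Complex.norm_I, Complex.norm_real,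
    Real.norm_eq_abs, Real.norm_eq_abs, one_mul, mul_one, mul_comm |vdiff E h x v|,
    mul_assoc |2 * Real.pi * t|]
  exact mul_le_mul_of_nonneg_left (hb v) (abs_nonneg _)

section

variable {G : Type*} [Group G] [MulAction G M]

/-- Invariance is a closed condition, so it survives the passage to the sup-norm closure. This is
what makes evaluation characters constant on orbits. -/
theorem apply_smul_of_mem_algebra {f : M →ᵇ ℂ} (hf : f ∈ algebra E G M) (g : G) (x : M) :
    f (g • x) = f x := by
  have hclosed : IsClosed {f : M →ᵇ ℂ | f (g • x) = f x} :=
    isClosed_eq (by fun_prop) (by fun_prop)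
  have hsub : (smoothAlgebra E G M : Set (M →ᵇ ℂ)) ⊆ {f | f (g • x) = f x} :=
    fun f hf => hf.1 g x
  exact closure_minimal hsub hclosed hf

variable (E G) in
/-- A smooth invariant function whose differential tends to zero at infinity. -/
structure SlowlyVarying (h : M → ℝ) : Prop where
  smooth : ContMDiff 𝓘(ℝ, E) 𝓘(ℝ, ℝ) ∞ h
  invariant : ∀ (g : G) (x : M), h (g • x) = h x
  vanishes : ∀ ε > 0, ∃ K : Set M, IsCocompact G K ∧ ∀ x ∉ K, ∀ v, |vdiff E h x v| ≤ ε * ‖v‖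

variable {h : M → ℝ}

/-- The phase of a slowly varying function, as an element of the algebra. -/
def phaseElem (hh : SlowlyVarying E G h) (t : ℝ) : algebra E G M :=
  ⟨BoundedContinuousFunction.ofNormedAddCommGroup (fun x => phase t (h x))
    ((contDiff_phase t).continuous.comp hh.smooth.continuous) 1 fun x => (norm_phase t _).le, by
    refine StarSubalgebra.le_topologicalClosure _ ⟨fun g x => ?_, ?_, fun ε hε => ?_⟩
    · change phase t (h (g • x)) = phase t (h x)
      rw [hh.invariant]
    · exact (contDiff_phase t).contMDiff.comp hh.smooth
    · obtain ⟨K, hK, hKv⟩ := hh.vanishes (ε / (|2 * Real.pi * t| + 1)) (by positivity)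
      refine ⟨K, hK, fun x hx => ?_⟩
      refine (normDiff_phase_le t (by positivity) (hh.smooth.mdifferentiable (by simp) x)
        (hKv x hx)).trans_lt ?_
      rw [mul_div_assoc', div_lt_iff₀ (by positivity)]
      nlinarith⟩

theorem phaseElem_apply (hh : SlowlyVarying E G h) (t : ℝ) (x : M) :
    (phaseElem hh t : M →ᵇ ℂ) x = phase t (h x) := rfl

theorem phaseElem_add (hh : SlowlyVarying E G h) (s t : ℝ) :
    phaseElem hh (s + t) = phaseElem hh s * phaseElem hh t := by
  ext x
  exact phase_add s t (h x)

theorem phaseElem_zero (hh : SlowlyVarying E G h) : phaseElem hh 0 = 1 := by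
  ext x
  exact phase_zero (h x)

instance : CompleteSpace (algebra E G M) :=
  (StarSubalgebra.isClosed_topologicalClosure _).completeSpace_coe

/-- Characters are contractive, and the phases of `t` and `-t` are mutually inverse of norm at most
1; two numbers in `[0, 1]` with product 1 both equal 1. -/
theorem norm_character_phaseElem (hh : SlowlyVarying E G h) (t : ℝ) (χ : Compactification E G M) :
    ‖χ (phaseElem hh t)‖ = 1 := by
  have hle : ∀ t, ‖χ (phaseElem hh t)‖ ≤ 1 := fun t => by
    have h1 : ‖phaseElem hh t‖ ≤ 1 :=
      BoundedContinuousFunction.norm_ofNormedAddCommGroup_le _ zero_le_one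
        fun x => (norm_phase t (h x)).le
    have h2 : ‖(1 : algebra E G M)‖ ≤ 1 :=
      (BoundedContinuousFunction.norm_le zero_le_one).2 fun x => by simp
    calc _ ≤ ‖phaseElem hh t‖ * ‖(1 : algebra E G M)‖ :=
          AlgHom.norm_apply_le_self_mul_norm_one χ _
      _ ≤ 1 := mul_le_one₀ h1 (norm_nonneg _) h2
  have hmul : ‖χ (phaseElem hh t)‖ * ‖χ (phaseElem hh (-t))‖ = 1 := by
    rw [← norm_mul, ← map_mul, ← phaseElem_add, add_neg_cancel, phaseElem_zero, map_one, norm_one]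
  nlinarith [hle t, hle (-t), norm_nonneg (χ (phaseElem hh t)),
    norm_nonneg (χ (phaseElem hh (-t)))]

/-- The circle-valued map on the compactification extending `t h`. -/
def phaseMap (hh : SlowlyVarying E G h) (t : ℝ) : C(Compactification E G M, UnitAddCircle) where
  toFun χ := (AddCircle.homeomorphCircle one_ne_zero).symm
    ⟨χ (phaseElem hh t), mem_sphere_zero_iff_norm.2 (norm_character_phaseElem hh t χ)⟩
  continuous_toFun := by
    refine (Homeomorph.continuous _).comp (Continuous.subtype_mk ?_ _)
    exact (WeakDual.eval_continuous (phaseElem hh t)).comp continuous_subtype_val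

theorem toCircle_phaseMap (hh : SlowlyVarying E G h) (t : ℝ) (χ : Compactification E G M) :
    ((AddCircle.toCircle (phaseMap hh t χ) : Circle) : ℂ) = χ (phaseElem hh t) := by
  rw [← AddCircle.homeomorphCircle_apply one_ne_zero]
  exact congrArg (Subtype.val) ((AddCircle.homeomorphCircle one_ne_zero).apply_symm_apply _)

theorem phaseMap_add (hh : SlowlyVarying E G h) (s t : ℝ) :
    phaseMap hh (s + t) = phaseMap hh s + phaseMap hh t := by
  ext χ
  apply AddCircle.injective_toCircle one_ne_zero
  apply Circle.ext
  rw [ContinuousMap.add_apply, AddCircle.toCircle_add, Circle.coe_mul, toCircle_phaseMap,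
    toCircle_phaseMap, toCircle_phaseMap, phaseElem_add, map_mul]

variable (E G) in
/-- Evaluation at a point, as a point of the compactification. -/
def evalChar (x : M) : Compactification E G M :=
  ⟨StrongDual.toWeakDual
    (LinearMap.mkContinuous
      { toFun := fun f : algebra E G M => (f : M →ᵇ ℂ) x
        map_add' := fun _ _ => rfl
        map_smul' := fun _ _ => rfl } 1 fun f => by
          rw [one_mul]; exact (f : M →ᵇ ℂ).norm_coe_le_norm x), by
    rw [WeakDual.CharacterSpace.eq_set_map_one_map_mul]
    exact ⟨rfl, fun f g => rfl⟩⟩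

theorem evalChar_apply (x : M) (f : algebra E G M) : evalChar E G x f = (f : M →ᵇ ℂ) x := rfl

theorem continuous_evalChar : Continuous (evalChar E G : M → Compactification E G M) :=
  continuous_induced_rng.2 (WeakDual.continuous_of_continuous_eval fun f =>
    (f : M →ᵇ ℂ).continuous)

theorem evalChar_smul (g : G) (x : M) : evalChar E G (g • x) = evalChar E G x :=
  WeakDual.CharacterSpace.ext fun f => apply_smul_of_mem_algebra f.2 g x

/-- A continuous invariant integer-valued function is constant if the orbit space is connected. -/
theorem exists_eq_const_of_integer_valued [ConnectedSpace (MulAction.orbitRel.Quotient G M)]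
    {D : M → ℝ} (hD : Continuous D) (hinv : ∀ (g : G) x, D (g • x) = D x)
    (hint : ∀ x, ∃ n : ℤ, D x = n) : ∃ c, ∀ x, D x = c := by
  choose n hn using hint
  have hncont : Continuous n := by
    rw [Int.isClosedEmbedding_coe_real.isInducing.continuous_iff]
    convert hD using 1
    ext x
    exact (hn x).symm
  have hninv : ∀ (g : G) x, n (g • x) = n x := fun g x => by
    have := hinv g x
    rw [hn, hn] at this
    exact_mod_cast this
  let nbar : MulAction.orbitRel.Quotient G M → ℤ := Quotient.lift n (by
    rintro a b ⟨g, rfl⟩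
    exact hninv g b)
  have hnbar : Continuous nbar := hncont.quotient_lift _
  obtain ⟨q⟩ : Nonempty (MulAction.orbitRel.Quotient G M) := inferInstance
  refine ⟨nbar q, fun x => ?_⟩
  rw [hn]
  have : nbar (Quotient.mk _ x) = nbar q := PreconnectedSpace.constant inferInstance hnbar
  exact_mod_cast this

/-- The homomorphism from the reals to Čech cohomology given by a slowly varying function. -/
def phaseHom (hh : SlowlyVarying E G h) : ℝ →+ Cech.H1 (Compactification E G M) :=
  (Cech.windingHom (Compactification E G M)).comp (AddMonoidHom.mk' (phaseMap hh) (phaseMap_add hh))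

theorem phaseHom_injective [ConnectedSpace (MulAction.orbitRel.Quotient G M)]
    (hh : SlowlyVarying E G h) (hunb : ∀ C, ∃ x, C < h x) :
    Function.Injective (phaseHom hh) := by
  rw [injective_iff_map_eq_zero]
  intro t ht
  obtain ⟨θ, hθ⟩ := Cech.exists_lift_of_windingHom_eq_zero ht
  have hθ : ∀ χ, ((θ χ : ℝ) : UnitAddCircle) = phaseMap hh t χ := hθ
  -- Restricted to `M`, both `t h` and `θ` lift the same circle-valued map.
  have hint : ∀ x, ∃ n : ℤ, t * h x - θ (evalChar E G x) = n := fun x => by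
    have h1 : ((t * h x : ℝ) : UnitAddCircle) = ((θ (evalChar E G x) : ℝ) : UnitAddCircle) := by
      apply AddCircle.injective_toCircle one_ne_zero
      apply Circle.ext
      rw [toCircle_coe_eq_phase, hθ, toCircle_phaseMap, evalChar_apply, phaseElem_apply]
    rw [← sub_eq_zero, ← AddCircle.coe_sub] at h1
    obtain ⟨n, hn⟩ := (AddCircle.coe_eq_zero_iff 1).1 h1
    exact ⟨n, by rw [← hn]; simp⟩
  obtain ⟨c, hc⟩ := exists_eq_const_of_integer_valued (G := G)
    (D := fun x => t * h x - θ (evalChar E G x))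
    ((hh.smooth.continuous.const_mul t).sub (θ.continuous.comp continuous_evalChar))
    (fun g x => by simp only [hh.invariant, evalChar_smul]) hint
  by_contra h0
  have ht0 : 0 < |t| := abs_pos.2 h0
  obtain ⟨x, hx⟩ := hunb ((|c| + ‖θ‖) / |t|)
  rw [div_lt_iff₀ ht0] at hx
  have h1 : t * h x = c + θ (evalChar E G x) := by linarith [hc x]
  have h2 : |t| * |h x| ≤ |c| + ‖θ‖ := by
    rw [← abs_mul, h1]
    -- The sup norm of `θ` is a bound because the compactification is compact.
    exact (abs_add_le _ _).trans (add_le_add le_rfl (θ.norm_coe_le_norm _))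
  nlinarith [le_abs_self (h x)]

theorem exists_addSubgroup_of_slowlyVarying [ConnectedSpace (MulAction.orbitRel.Quotient G M)]
    (hh : SlowlyVarying E G h) (hunb : ∀ C, ∃ x, C < h x) :
    ∃ S : AddSubgroup (Cech.H1 (Compactification E G M)), Nonempty (S ≃+ ℝ) :=
  ⟨(phaseHom hh).range, ⟨(AddMonoidHom.ofInjective (phaseHom_injective hh hunb)).symm⟩⟩

end
end Higson
end

/-! ### Charts with uniformly bounded distortion. -/

noncomputable section

namespace Higson
open Filter Topology
universe u
section bundle

variable
  {B : Type*} [TopologicalSpace B]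
  {F : Type*} [NormedAddCommGroup F] [NormedSpace ℝ F]
  {E : B → Type u} [TopologicalSpace (TotalSpace F E)] [∀ x, NormedAddCommGroup (E x)]
  [∀ x, InnerProductSpace ℝ (E x)]
  [FiberBundle F E] [VectorBundle ℝ F E]
  [IsContinuousRiemannianBundle F E]

variable (F E) in
-- The model `V` is the fibre at `x` with its own inner product. The trivialization at `x`, read
-- through `V`, is the identity at `x`, so by continuity of the metric it distorts norms by at most
-- 2 nearby. The constant does not depend on `x`, whereas comparison with the fixed norm of `F`
-- would give a constant that does.
theorem exists_normed_model_bundle (x : B) :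
    ∃ (V : Type u) (_ : NormedAddCommGroup V) (_ : InnerProductSpace ℝ V) (A : V ≃L[ℝ] F),
      ∀ᶠ y in 𝓝 x,
        (∀ w : E y, ‖A.symm ((trivializationAt F E x).continuousLinearMapAt ℝ y w)‖ ≤ 2 * ‖w‖) ∧
        ∀ v : V, ‖(trivializationAt F E x).symmL ℝ y (A v)‖ ≤ 2 * ‖v‖ := by
  have hx : x ∈ (trivializationAt F E x).baseSet := FiberBundle.mem_baseSet_trivializationAt' x
  refine ⟨E x, inferInstance, inferInstance,
    (trivializationAt F E x).continuousLinearEquivAt ℝ x hx, ?_⟩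
  filter_upwards [eventually_norm_symmL_trivializationAt_self_comp_lt F E x one_lt_two,
    eventually_norm_symmL_trivializationAt_comp_self_lt F E x one_lt_two] with y h1 h2
  refine ⟨fun w => ?_, fun v => ?_⟩
  · have := ContinuousLinearMap.le_of_opNorm_le _ h1.le w
    rwa [Trivialization.symm_continuousLinearEquivAt_eq]
  · have := (ContinuousLinearMap.le_of_opNorm_le _ h2.le v)
    rw [Trivialization.coe_continuousLinearEquivAt_eq]
    exact this

end bundle

section normedChart

variable {E : Type u} [NormedAddCommGroup E] [NormedSpace ℝ E]
  {M : Type*} [TopologicalSpace M] [ChartedSpace E M]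
  [RiemannianBundle (fun x : M => TangentSpace 𝓘(ℝ, E) x)]

/-- Tangent spaces at different points share the underlying space `E`, but their norms depend on the
base point; this moves a norm along an equality of base points. -/
theorem norm_tangent_congr {y y' : M} (h : y' = y) (u : E) :
    ‖(show TangentSpace 𝓘(ℝ, E) y' from u)‖ = ‖(show TangentSpace 𝓘(ℝ, E) y from u)‖ := by
  subst h; rfl

variable [IsManifold 𝓘(ℝ, E) ∞ M]
  [IsContMDiffRiemannianBundle 𝓘(ℝ, E) ∞ E (fun x : M => TangentSpace 𝓘(ℝ, E) x)]

scoped instance : IsManifold 𝓘(ℝ, E) 1 M := .of_le (n := ∞) (by simp)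

theorem exists_normed_model (x : M) :
    ∃ (V : Type u) (_ : NormedAddCommGroup V) (_ : InnerProductSpace ℝ V) (A : V ≃L[ℝ] E),
      ∀ᶠ y in 𝓝 x,
        (∀ w : TangentSpace 𝓘(ℝ, E) y,
          ‖A.symm (mfderiv 𝓘(ℝ, E) 𝓘(ℝ, E) (chartAt E x) y w)‖ ≤ 2 * ‖w‖) ∧
        ∀ v : V, ‖mfderiv 𝓘(ℝ, E) 𝓘(ℝ, E) (chartAt E x).symm (chartAt E x y) (A v)‖
          ≤ 2 * ‖v‖ := by
  have : IsContinuousRiemannianBundle E (fun x : M => TangentSpace 𝓘(ℝ, E) x) := by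
    obtain ⟨g, hg, hg'⟩ := IsContMDiffRiemannianBundle.exists_contMDiff (IB := 𝓘(ℝ, E)) (n := ∞)
      (F := E) (E := fun x : M => TangentSpace 𝓘(ℝ, E) x)
    exact ⟨g, hg.continuous, hg'⟩
  obtain ⟨V, i1, i2, A, hA⟩ := exists_normed_model_bundle E (fun x : M => TangentSpace 𝓘(ℝ, E) x) x
  refine ⟨V, i1, i2, A, ?_⟩
  filter_upwards [hA, chart_source_mem_nhds E x] with y hy h'y
  have e1 := TangentBundle.symmL_trivializationAt (I := 𝓘(ℝ, E)) h'y
  have e2 := TangentBundle.continuousLinearMapAt_trivializationAt (I := 𝓘(ℝ, E)) h'y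
  refine ⟨fun w => ?_, fun v => ?_⟩
  · have := hy.1 w
    rw [e2] at this
    exact this
  · have := hy.2 v
    rw [e1, modelWithCornersSelf_coe, Set.range_id, mfderivWithin_univ] at this
    refine (norm_tangent_congr (E := E) ?_ _).trans_le this
    exact (chartAt E x).left_inv h'y

/-- The target is shrunk to a ball so that it is convex and both norm bounds hold throughout.
Convexity later turns the bound on the inverse chart into a Lipschitz bound along segments. -/
theorem exists_normed_chart [FiniteDimensional ℝ E] (x : M) :
    ∃ (V : Type u) (_ : NormedAddCommGroup V) (_ : InnerProductSpace ℝ V)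
      (_ : FiniteDimensional ℝ V) (κ : OpenPartialHomeomorph M V) (r : ℝ), 0 < r ∧
      x ∈ κ.source ∧ κ.target = Metric.ball (κ x) r ∧
      ContMDiffOn 𝓘(ℝ, E) 𝓘(ℝ, V) ∞ κ κ.source ∧
      ContMDiffOn 𝓘(ℝ, V) 𝓘(ℝ, E) ∞ κ.symm κ.target ∧
      (∀ y ∈ κ.source, ∀ w : TangentSpace 𝓘(ℝ, E) y,
        ‖vdiff E κ y w‖ ≤ 2 * ‖w‖) ∧
      (∀ z ∈ κ.target, ∀ v : V,
        ‖mfderiv 𝓘(ℝ, V) 𝓘(ℝ, E) κ.symm z v‖ ≤ 2 * ‖v‖) := by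
  obtain ⟨V, i1, i2, A, hA⟩ := exists_normed_model (E := E) x
  have hfin : FiniteDimensional ℝ V := A.symm.toLinearEquiv.finiteDimensional
  let e : OpenPartialHomeomorph M V :=
    (chartAt E x).trans A.symm.toHomeomorph.toOpenPartialHomeomorph
  have hes : e.source = (chartAt E x).source := by simp [e]
  have hxe : x ∈ e.source := by rw [hes]; exact mem_chart_source E x
  have hA' := (e.symm.continuousAt (x := e x) (e.map_source hxe)).eventually
    (by rw [e.left_inv hxe]; exact hA)
  obtain ⟨r, hr, hball⟩ := Metric.mem_nhds_iff.1
    (Filter.inter_mem (e.open_target.mem_nhds (e.map_source hxe)) hA')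
  let κ : OpenPartialHomeomorph M V :=
    (e.symm.restrOpen (Metric.ball (e x) r) Metric.isOpen_ball).symm
  have hκt : κ.target = Metric.ball (e x) r := by
    change e.target ∩ _ = _
    exact Set.inter_eq_right.2 fun z hz => (hball hz).1
  have hκs : ∀ y ∈ κ.source, y ∈ e.source ∧ e y ∈ Metric.ball (e x) r := fun y hy => by
    have h1 : κ y ∈ κ.target := κ.map_source hy
    rw [hκt] at h1
    refine ⟨?_, h1⟩
    have h2 : κ.symm (κ y) ∈ e.source := e.symm.map_source (hball h1).1
    rwa [κ.left_inv hy] at h2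
  have hκ : (κ : M → V) = A.symm ∘ chartAt E x := rfl
  have hκ' : (κ.symm : V → M) = (chartAt E x).symm ∘ A := rfl
  refine ⟨V, i1, i2, hfin, κ, r, hr, ?_, hκt, ?_, ?_, ?_, ?_⟩
  · have : κ.symm (e x) ∈ κ.source := κ.symm.map_source (by
      change e x ∈ κ.target
      rw [hκt]; exact Metric.mem_ball_self hr)
    have h2 : κ.symm (e x) = x := e.left_inv hxe
    rwa [h2] at this
  · rw [hκ]
    exact A.symm.contDiff.contMDiff.comp_contMDiffOn
      ((contMDiffOn_chart (I := 𝓘(ℝ, E))).mono fun y hy => hes ▸ (hκs y hy).1)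
  · rw [hκ']
    refine (contMDiffOn_chart_symm (I := 𝓘(ℝ, E))).comp A.contDiff.contMDiff.contMDiffOn ?_
    intro z hz
    rw [hκt] at hz
    have := (hball hz).1
    simpa [e] using this
  · intro y hy w
    obtain ⟨h1, h2⟩ := hκs y hy
    have h3 := (hball h2).2
    simp only [Set.mem_ofPred_eq] at h3
    rw [e.left_inv h1] at h3
    have hd := HasMFDerivAt.comp (I := 𝓘(ℝ, E)) (I'' := 𝓘(ℝ, V)) y
      (A.symm.toContinuousLinearMap.hasMFDerivAt (x := chartAt E x y))
        ((contMDiffOn_chart (I := 𝓘(ℝ, E)) (n := 1)).contMDiffAt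
          ((chartAt E x).open_source.mem_nhds (hes ▸ h1)) |>.mdifferentiableAt
            one_ne_zero).hasMFDerivAt
    rw [show vdiff E κ y = _ from hd.mfderiv]
    exact h3.1 w
  · intro z hz v
    rw [hκt] at hz
    have h1 := (hball hz).1
    have h3 := (hball hz).2
    simp only [Set.mem_ofPred_eq] at h3
    have h4 : A z ∈ (chartAt E x).target := by simpa [e] using h1
    have h5 : chartAt E x (e.symm z) = A z := (chartAt E x).right_inv h4
    rw [h5] at h3
    have hd := HasMFDerivAt.comp (I := 𝓘(ℝ, V)) (I'' := 𝓘(ℝ, E)) z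
      ((contMDiffOn_chart_symm (I := 𝓘(ℝ, E)) (n := 1)).contMDiffAt
          ((chartAt E x).open_target.mem_nhds h4) |>.mdifferentiableAt
            one_ne_zero).hasMFDerivAt (A.toContinuousLinearMap.hasMFDerivAt (x := z))
    rw [show mfderiv 𝓘(ℝ, V) 𝓘(ℝ, E) κ.symm z = _ from hd.mfderiv]
    exact h3.2 v
end normedChart

end Higson
end

/-! ### Mollification of Lipschitz functions and Lipschitz bounds from differentials. -/

noncomputable section

namespace Higson

open MeasureTheory in
/-- A Lipschitz function on a Euclidean space is a uniform limit of smooth functions with the same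
Lipschitz constant. -/
theorem exists_contDiff_lipschitz_approx {V : Type*} [NormedAddCommGroup V]
    [InnerProductSpace ℝ V] [FiniteDimensional ℝ V] {F : V → ℝ} {C : NNReal}
    (hF : LipschitzWith C F) {δ : ℝ} (hδ : 0 < δ) :
    ∃ g : V → ℝ, ContDiff ℝ ∞ g ∧ LipschitzWith C g ∧ ∀ z, |g z - F z| ≤ δ := by
  borelize V
  -- On a ball of this radius `F` varies by at most `C * r ≤ δ`; the `+ 1` covers `C = 0`.
  let r : ℝ := δ / (C + 1)
  have hr : 0 < r := by positivity
  let φ : ContDiffBump (0 : V) := ⟨r / 2, r, by positivity, by linarith⟩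
  let g : V → ℝ := fun z => ∫ t, φ.normed volume t • F (z - t)
  have hφ : Integrable (φ.normed volume : V → ℝ) := φ.integrable_normed
  have hint : ∀ z, Integrable fun t => φ.normed volume t • F (z - t) := fun z =>
    (φ.contDiff_normed (n := 0)).continuous.smul
      (hF.continuous.comp (continuous_const.sub continuous_id))
      |>.integrable_of_hasCompactSupport φ.hasCompactSupport_normed.smul_right
  refine ⟨g, ?_, ?_, fun z => ?_⟩
  · exact HasCompactSupport.contDiff_convolution_left (ContinuousLinearMap.lsmul ℝ ℝ)
      φ.hasCompactSupport_normed φ.contDiff_normed hF.continuous.locallyIntegrable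
  · refine LipschitzWith.of_dist_le_mul fun x y => ?_
    have h1 : g x - g y = ∫ t, φ.normed volume t • (F (x - t) - F (y - t)) := by
      simp only [smul_sub]
      exact (integral_sub (hint x) (hint y)).symm
    rw [Real.dist_eq, ← Real.norm_eq_abs, h1]
    calc _ ≤ ∫ t, φ.normed volume t * (C * dist x y) := by
          refine norm_integral_le_of_norm_le (hφ.mul_const _) (.of_forall fun t => ?_)
          rw [norm_smul, Real.norm_of_nonneg (φ.nonneg_normed t)]
          refine mul_le_mul_of_nonneg_left ?_ (φ.nonneg_normed t)
          simpa [Real.dist_eq] using hF.dist_le_mul (x - t) (y - t)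
      _ = C * dist x y := by rw [integral_mul_const, φ.integral_normed, one_mul]
  · have h := φ.dist_normed_convolution_le (μ := volume) (x₀ := z) (ε := δ) (g := F)
      hF.continuous.aestronglyMeasurable fun x hx => by
        have h1 : dist x z ≤ r := hx.le
        calc dist (F x) (F z) ≤ C * dist x z := hF.dist_le_mul x z
          _ ≤ C * r := by gcongr
          _ ≤ (C + 1) * r := by nlinarith
          _ = δ := by simp only [r]; field_simp
    exact h

theorem enorm_le_of_norm_le {A B : Type*} [NormedAddCommGroup A] [NormedAddCommGroup B] {a : A}
    {b : B} {C : NNReal} (h : ‖a‖ ≤ C * ‖b‖) : ‖a‖ₑ ≤ C * ‖b‖ₑ := by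
  simp only [enorm]
  exact_mod_cast h

open Manifold in
/-- A map from a ball whose differential is bounded by `C` is `C`-Lipschitz. -/
theorem edist_le_of_norm_mfderiv_le {E : Type*} [NormedAddCommGroup E] [NormedSpace ℝ E]
    {M : Type*} [EMetricSpace M] [ChartedSpace E M]
    [RiemannianBundle (fun x : M => TangentSpace 𝓘(ℝ, E) x)] [IsRiemannianManifold 𝓘(ℝ, E) M]
    {V : Type*} [NormedAddCommGroup V] [NormedSpace ℝ V] {s : Set V} (hs : Convex ℝ s)
    (hso : IsOpen s) {e : V → M}
    (he : ContMDiffOn 𝓘(ℝ, V) 𝓘(ℝ, E) ∞ e s) {C : NNReal}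
    (hC : ∀ z ∈ s, ∀ v : V, ‖mfderiv 𝓘(ℝ, V) 𝓘(ℝ, E) e z v‖ ≤ C * ‖v‖) {z z' : V}
    (hz : z ∈ s) (hz' : z' ∈ s) : edist (e z) (e z') ≤ C * edist z z' := by
  rw [IsRiemannianManifold.out (I := 𝓘(ℝ, E)) (e z) (e z')]
  -- The segment stays in the convex set `s`, and the length of its image, at most `C * edist z z'`,
  -- bounds the Riemannian distance.
  let η : ℝ → V := fun t => z + t • (z' - z)
  have hη : ∀ t ∈ Set.Icc (0 : ℝ) 1, η t ∈ s := fun t ht =>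
    hs.add_smul_sub_mem hz hz' ht
  have hηd : ContDiff ℝ 1 η := by fun_prop
  have hγ : ContMDiffOn 𝓘(ℝ, ℝ) 𝓘(ℝ, E) 1 (e ∘ η) (Set.Icc 0 1) :=
    (he.of_le (by simp)).comp hηd.contMDiff.contMDiffOn hη
  refine (riemannianEDist_le_pathELength hγ (x := e z) (y := e z') (by simp [η]) (by simp [η])
    zero_le_one).trans ?_
  rw [pathELength_eq_lintegral_mfderiv_Icc]
  calc _ ≤ ∫⁻ t in Set.Icc (0 : ℝ) 1, C * edist z z' := by
        refine MeasureTheory.setLIntegral_mono' measurableSet_Icc fun t ht => ?_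
        have hη' : HasDerivAt η (z' - z) t := by
          have := ((hasDerivAt_id t).smul_const (z' - z)).const_add z
          rwa [one_smul] at this
        have hd := HasMFDerivAt.comp t ((he.contMDiffAt (hso.mem_nhds (hη t ht))).mdifferentiableAt
          (by simp)).hasMFDerivAt hη'.hasFDerivAt.hasMFDerivAt
        rw [hd.mfderiv]
        have h1 := hC _ (hη t ht) (z' - z)
        have h2 := enorm_le_of_norm_le h1
        rw [edist_comm, edist_eq_enorm_sub]
        have h3 : (mfderiv 𝓘(ℝ, V) 𝓘(ℝ, E) e (η t) ∘L
            ContinuousLinearMap.toSpanSingleton ℝ (z' - z)) (1 : ℝ) =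
              mfderiv 𝓘(ℝ, V) 𝓘(ℝ, E) e (η t) (z' - z) :=
          congrArg (mfderiv 𝓘(ℝ, V) 𝓘(ℝ, E) e (η t)) (one_smul ℝ (z' - z))
        exact (congrArg (‖·‖ₑ) h3).trans_le h2
    _ = _ := by simp

end Higson
end

/-! ### Local smoothing of a Lipschitz function with a controlled differential. -/

noncomputable section

namespace Higson

section pullback

variable {E : Type*} [NormedAddCommGroup E] [NormedSpace ℝ E]
  {M : Type*} [TopologicalSpace M] [ChartedSpace E M]
  {V : Type*} [NormedAddCommGroup V] [NormedSpace ℝ V]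

/-- The extension by zero of the pullback of a function under a chart. -/
def chartPull (κ : OpenPartialHomeomorph M V) (β : V → ℝ) : M → ℝ :=
  κ.source.indicator (β ∘ κ)

theorem chartPull_of_mem {κ : OpenPartialHomeomorph M V} (β : V → ℝ) {y : M} (hy : y ∈ κ.source) :
    chartPull κ β y = β (κ y) := Set.indicator_of_mem hy _

theorem chartPull_of_notMem {κ : OpenPartialHomeomorph M V} (β : V → ℝ) {y : M}
    (hy : y ∉ κ.source) : chartPull κ β y = 0 := Set.indicator_of_notMem hy _

theorem chartPull_eventuallyEq {κ : OpenPartialHomeomorph M V} (β : V → ℝ) {y : M}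
    (hy : y ∈ κ.source) : chartPull κ β =ᶠ[nhds y] β ∘ κ := by
  filter_upwards [κ.open_source.mem_nhds hy] with z hz using chartPull_of_mem β hz

variable {κ : OpenPartialHomeomorph M V} {β : V → ℝ}

theorem chartPull_eq_zero_of_notMem_image {y : M} (hy : y ∉ κ.symm '' tsupport β) :
    chartPull κ β y = 0 := by
  by_cases hs : y ∈ κ.source
  · rw [chartPull_of_mem β hs]
    by_contra h
    exact hy ⟨κ y, subset_tsupport _ h, κ.left_inv hs⟩
  · exact chartPull_of_notMem β hs

theorem isCompact_image_tsupport (hβc : HasCompactSupport β) (hβt : tsupport β ⊆ κ.target) :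
    IsCompact (κ.symm '' tsupport β) :=
  hβc.isCompact.image_of_continuousOn (κ.continuousOn_symm.mono hβt)

theorem hasCompactSupport_chartPull [T2Space M] (hβc : HasCompactSupport β)
    (hβt : tsupport β ⊆ κ.target) : HasCompactSupport (chartPull κ β) :=
  HasCompactSupport.intro (isCompact_image_tsupport hβc hβt) fun _ h =>
    chartPull_eq_zero_of_notMem_image h

theorem chartPull_eventuallyEq_zero [T2Space M] (hβc : HasCompactSupport β)
    (hβt : tsupport β ⊆ κ.target) {y : M} (hy : y ∉ κ.source) :
    chartPull κ β =ᶠ[nhds y] fun _ => 0 := by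
  have h1 : y ∉ κ.symm '' tsupport β := by
    rintro ⟨z, hz, rfl⟩
    exact hy (κ.map_target (hβt hz))
  filter_upwards [(isCompact_image_tsupport hβc hβt).isClosed.isOpen_compl.mem_nhds h1] with z hz
  exact chartPull_eq_zero_of_notMem_image hz

theorem contMDiff_chartPull [T2Space M] (hκ : ContMDiffOn 𝓘(ℝ, E) 𝓘(ℝ, V) ∞ κ κ.source)
    (hβ : ContDiff ℝ ∞ β) (hβc : HasCompactSupport β) (hβt : tsupport β ⊆ κ.target) :
    ContMDiff 𝓘(ℝ, E) 𝓘(ℝ, ℝ) ∞ (chartPull κ β) := by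
  intro y
  by_cases hy : y ∈ κ.source
  · exact (hβ.contMDiff.contMDiffAt.comp y
      (hκ.contMDiffAt (κ.open_source.mem_nhds hy))).congr_of_eventuallyEq
        (chartPull_eventuallyEq β hy)
  · exact contMDiffAt_const.congr_of_eventuallyEq (chartPull_eventuallyEq_zero hβc hβt hy)

theorem vdiff_chartPull_of_mem (hκ : ContMDiffOn 𝓘(ℝ, E) 𝓘(ℝ, V) ∞ κ κ.source)
    (hβ : ContDiff ℝ ∞ β) {y : M} (hy : y ∈ κ.source) (w : TangentSpace 𝓘(ℝ, E) y) :
    vdiff E (chartPull κ β) y w = fderiv ℝ β (κ y) (vdiff E κ y w) := by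
  have h1 : HasMFDerivAt 𝓘(ℝ, E) 𝓘(ℝ, ℝ) (β ∘ κ) y (fderiv ℝ β (κ y) ∘L vdiff E κ y) :=
    HasMFDerivAt.comp y (hβ.differentiable (by simp) (κ y)).hasFDerivAt.hasMFDerivAt
      (hasMFDerivAt_vdiff ((hκ.contMDiffAt (κ.open_source.mem_nhds hy)).mdifferentiableAt
        (by simp)))
  rw [vdiff_eq_of_hasMFDerivAt (h1.congr_of_eventuallyEq (chartPull_eventuallyEq β hy))]
  rfl

theorem vdiff_chartPull_of_notMem [T2Space M] (hβc : HasCompactSupport β)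
    (hβt : tsupport β ⊆ κ.target) {y : M} (hy : y ∉ κ.source) :
    vdiff E (chartPull κ β) y = 0 :=
  vdiff_eq_of_hasMFDerivAt ((hasMFDerivAt_const (0 : ℝ) y).congr_of_eventuallyEq
    (chartPull_eventuallyEq_zero hβc hβt hy))

end pullback

section data

variable {E : Type*} [NormedAddCommGroup E] [NormedSpace ℝ E]
  {M : Type*} [TopologicalSpace M] [ChartedSpace E M]
  [RiemannianBundle (fun x : M => TangentSpace 𝓘(ℝ, E) x)]

variable (E) in
/-- A non-negative compactly supported smooth function `φ` together with a smooth compactly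
supported bound `η` for its differential. -/
structure IsBumpPair (φ η : M → ℝ) : Prop where
  smooth : ContMDiff 𝓘(ℝ, E) 𝓘(ℝ, ℝ) ∞ φ
  smooth' : ContMDiff 𝓘(ℝ, E) 𝓘(ℝ, ℝ) ∞ η
  compact : HasCompactSupport φ
  compact' : HasCompactSupport η
  nonneg : ∀ x, 0 ≤ φ x
  nonneg' : ∀ x, 0 ≤ η x
  bound : ∀ x w, |vdiff E φ x w| ≤ η x * ‖w‖

variable (E) in
/-- A smooth approximation `P` of `f * φ` such that `dP` is close to `φ df + f dφ` for a form `df`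
of norm at most `4`. -/
structure IsBumpApprox (f φ η : M → ℝ) (δ : ℝ) (P : M → ℝ) : Prop where
  smooth : ContMDiff 𝓘(ℝ, E) 𝓘(ℝ, ℝ) ∞ P
  compact : HasCompactSupport P
  approx : ∀ x, |P x - f x * φ x| ≤ δ * φ x
  approx' : ∀ x w, |vdiff E P x w - f x * vdiff E φ x w| ≤ (4 * φ x + δ * η x) * ‖w‖

variable (E) in
/-- `f` can be smoothly approximated with bounded differential on a neighbourhood of `s`. -/
def HasSmoothing (f : M → ℝ) (s : Set M) : Prop :=
  ∃ φ η : M → ℝ, IsBumpPair E φ η ∧ (∀ x ∈ s, 0 < φ x) ∧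
    ∀ δ > 0, ∃ P, IsBumpApprox E f φ η δ P

theorem vdiff_add {f g : M → ℝ} (hf : ContMDiff 𝓘(ℝ, E) 𝓘(ℝ, ℝ) ∞ f)
    (hg : ContMDiff 𝓘(ℝ, E) 𝓘(ℝ, ℝ) ∞ g) (x : M) :
    vdiff E (f + g) x = vdiff E f x + vdiff E g x :=
  vdiff_eq_of_hasMFDerivAt ((hasMFDerivAt_vdiff (hf.mdifferentiable (by simp) x)).add
    (hasMFDerivAt_vdiff (hg.mdifferentiable (by simp) x)))

theorem vdiff_const (c : ℝ) (x : M) : vdiff E (fun _ : M => c) x = 0 :=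
  vdiff_eq_of_hasMFDerivAt (hasMFDerivAt_const c x)

/-- The approximation conditions compare `P` with `f * φ` rather than with `f`, so bumps, bounds and
approximations simply add, with no partition of unity. Dividing by `φ` is deferred to the end. Since
`φ` and `η` precede `δ`, the error `δ * η / φ` can still be made small then. -/
theorem HasSmoothing.union {f : M → ℝ} {s t : Set M} (hs : HasSmoothing E f s)
    (ht : HasSmoothing E f t) : HasSmoothing E f (s ∪ t) := by
  obtain ⟨φ₁, η₁, h₁, hp₁, ha₁⟩ := hs
  obtain ⟨φ₂, η₂, h₂, hp₂, ha₂⟩ := ht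
  refine ⟨φ₁ + φ₂, η₁ + η₂, ⟨h₁.smooth.add h₂.smooth, h₁.smooth'.add h₂.smooth',
    h₁.compact.add h₂.compact, h₁.compact'.add h₂.compact',
    fun x => add_nonneg (h₁.nonneg x) (h₂.nonneg x),
    fun x => add_nonneg (h₁.nonneg' x) (h₂.nonneg' x), fun x w => ?_⟩, ?_, fun δ hδ => ?_⟩
  · rw [vdiff_add h₁.smooth h₂.smooth, Pi.add_apply, add_mul]
    exact (abs_add_le _ _).trans (add_le_add (h₁.bound x w) (h₂.bound x w))
  · rintro x (hx | hx)
    · exact add_pos_of_pos_of_nonneg (hp₁ x hx) (h₂.nonneg x)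
    · exact add_pos_of_nonneg_of_pos (h₁.nonneg x) (hp₂ x hx)
  · obtain ⟨P₁, hP₁⟩ := ha₁ δ hδ
    obtain ⟨P₂, hP₂⟩ := ha₂ δ hδ
    refine ⟨P₁ + P₂, hP₁.smooth.add hP₂.smooth, hP₁.compact.add hP₂.compact, fun x => ?_,
      fun x w => ?_⟩
    · simp only [Pi.add_apply]
      calc |P₁ x + P₂ x - f x * (φ₁ x + φ₂ x)|
          = |(P₁ x - f x * φ₁ x) + (P₂ x - f x * φ₂ x)| := by congr 1; ring
        _ ≤ δ * φ₁ x + δ * φ₂ x :=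
          (abs_add_le _ _).trans (add_le_add (hP₁.approx x) (hP₂.approx x))
        _ = _ := by ring
    · rw [vdiff_add hP₁.smooth hP₂.smooth, vdiff_add h₁.smooth h₂.smooth]
      simp only [Pi.add_apply, add_apply]
      calc _ = |(vdiff E P₁ x w - f x * vdiff E φ₁ x w) +
              (vdiff E P₂ x w - f x * vdiff E φ₂ x w)| := by congr 1; ring
        _ ≤ (4 * φ₁ x + δ * η₁ x) * ‖w‖ + (4 * φ₂ x + δ * η₂ x) * ‖w‖ :=
          (abs_add_le _ _).trans (add_le_add (hP₁.approx' x w) (hP₂.approx' x w))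
        _ = _ := by ring

theorem hasSmoothing_empty (f : M → ℝ) : HasSmoothing E f ∅ := by
  refine ⟨0, 0, ⟨contMDiff_const, contMDiff_const, .zero, .zero, fun _ => le_rfl, fun _ => le_rfl,
    fun x w => ?_⟩, by simp, fun δ hδ => ⟨0, contMDiff_const, .zero, by simp, fun x w => ?_⟩⟩
  · rw [show vdiff E (0 : M → ℝ) x = 0 from vdiff_const 0 x]
    simp
  · rw [show vdiff E (0 : M → ℝ) x = 0 from vdiff_const 0 x]
    simp

end data

section

variable {E : Type*} [NormedAddCommGroup E] [NormedSpace ℝ E] [FiniteDimensional ℝ E]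
  {M : Type*} [EMetricSpace M] [ChartedSpace E M] [IsManifold 𝓘(ℝ, E) ∞ M]
  [RiemannianBundle (fun x : M => TangentSpace 𝓘(ℝ, E) x)]
  [IsContMDiffRiemannianBundle 𝓘(ℝ, E) ∞ E (fun x : M => TangentSpace 𝓘(ℝ, E) x)]
  [IsRiemannianManifold 𝓘(ℝ, E) M]

theorem exists_hasSmoothing_nhds {f : M → ℝ} (hf : LipschitzWith 1 f) (x : M) :
    ∃ s ∈ nhds x, HasSmoothing E f s := by
  obtain ⟨V, _, _, _, κ, r, hr, hx, hκt, hκ, hκ', hb, hb'⟩ := exists_normed_chart (E := E) x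
  have hF : LipschitzOnWith 2 (f ∘ κ.symm) κ.target := by
    intro z hz z' hz'
    refine (hf _ _).trans ?_
    rw [ENNReal.coe_one, one_mul]
    exact edist_le_of_norm_mfderiv_le (hκt ▸ convex_ball _ _) κ.open_target hκ'
      (C := 2) hb' hz hz'
  -- Extending to all of `V` with the same Lipschitz constant allows convolution without boundary
  -- effects.
  obtain ⟨F, hFL, hFe⟩ := hF.extend_real
  have hFf : ∀ y ∈ κ.source, F (κ y) = f y := fun y hy => by
    rw [← hFe (κ.map_source hy), Function.comp_apply, κ.left_inv hy]
  let β₁ : ContDiffBump (κ x) := ⟨r / 4, r / 2, by positivity, by linarith⟩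
  -- `β₂` is 1 on the support of `β₁`, so a multiple of it is a smooth bound for `dβ₁`. The multiple
  -- is `2 * B`, the 2 coming from the bound on the differential of `κ`.
  let β₂ : ContDiffBump (κ x) := ⟨r / 2, 3 * r / 4, by positivity, by linarith⟩
  have ht₁ : tsupport β₁ ⊆ κ.target := by
    rw [β₁.tsupport_eq, hκt]
    exact Metric.closedBall_subset_ball (by simp only [β₁]; linarith)
  have ht₂ : tsupport β₂ ⊆ κ.target := by
    rw [β₂.tsupport_eq, hκt]
    exact Metric.closedBall_subset_ball (by simp only [β₂]; linarith)
  have hβ₁ : ContDiff ℝ ∞ β₁ := β₁.contDiff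
  obtain ⟨B, hB⟩ := (β₁.hasCompactSupport.fderiv ℝ).exists_bound_of_continuous
    (hβ₁.continuous_fderiv (by simp))
  have hB0 : 0 ≤ B := (norm_nonneg _).trans (hB 0)
  let b₂ : V → ℝ := fun z => 2 * B * β₂ z
  have hb₂ : ContDiff ℝ ∞ b₂ := contDiff_const.mul β₂.contDiff
  have hsupp : tsupport b₂ ⊆ tsupport β₂ := closure_mono (Function.support_mul_subset_right _ _)
  have hb₂c : HasCompactSupport b₂ := β₂.hasCompactSupport.mul_left
  have hbound : ∀ y ∈ κ.source, ∀ w : TangentSpace 𝓘(ℝ, E) y,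
      |fderiv ℝ β₁ (κ y) (vdiff E κ y w)| ≤ b₂ (κ y) * ‖w‖ := by
    intro y hy w
    by_cases hz : κ y ∈ Metric.closedBall (κ x) (r / 2)
    · have h1 : β₂ (κ y) = 1 := β₂.one_of_mem_closedBall hz
      calc |fderiv ℝ β₁ (κ y) (vdiff E κ y w)| ≤ B * (2 * ‖w‖) :=
            (ContinuousLinearMap.le_of_opNorm_le _ (hB _) _).trans
              (mul_le_mul_of_nonneg_left (hb y hy w) hB0)
        _ = b₂ (κ y) * ‖w‖ := by simp only [b₂, h1]; ring
    · have h1 : fderiv ℝ β₁ (κ y) = 0 := by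
        by_contra h
        exact hz (β₁.tsupport_eq ▸ (support_fderiv_subset ℝ h))
      rw [h1]
      simp only [b₂, zero_apply, abs_zero]
      have := β₂.nonneg (x := κ y)
      positivity
  refine ⟨κ.source ∩ κ ⁻¹' Metric.ball (κ x) (r / 4), ?_, chartPull κ β₁, chartPull κ b₂,
    ⟨contMDiff_chartPull hκ hβ₁ β₁.hasCompactSupport ht₁,
      contMDiff_chartPull hκ hb₂ hb₂c (hsupp.trans ht₂),
      hasCompactSupport_chartPull β₁.hasCompactSupport ht₁,
      hasCompactSupport_chartPull hb₂c (hsupp.trans ht₂),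
      fun y => Set.indicator_nonneg (fun y _ => β₁.nonneg) y,
      fun y => Set.indicator_nonneg (fun y _ => ?_) y, fun y w => ?_⟩, ?_, fun δ hδ => ?_⟩
  · exact Filter.inter_mem (κ.open_source.mem_nhds hx)
      ((κ.continuousAt hx).preimage_mem_nhds (Metric.ball_mem_nhds _ (by positivity)))
  · have := β₂.nonneg (x := κ y)
    simp only [Function.comp_apply, b₂]
    positivity
  · by_cases hy : y ∈ κ.source
    · rw [vdiff_chartPull_of_mem hκ hβ₁ hy, chartPull_of_mem _ hy]
      exact hbound y hy w
    · rw [vdiff_chartPull_of_notMem β₁.hasCompactSupport ht₁ hy, chartPull_of_notMem _ hy]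
      simp
  · rintro y ⟨hy, hy'⟩
    rw [chartPull_of_mem _ hy]
    refine β₁.pos_of_mem_ball (Metric.ball_subset_ball ?_ hy')
    simp only [β₁]
    linarith
  · obtain ⟨g, hg, hgL, hgF⟩ := exists_contDiff_lipschitz_approx hFL hδ
    have hc : HasCompactSupport fun z => β₁ z * g z := β₁.hasCompactSupport.mul_right
    have ht : tsupport (fun z => β₁ z * g z) ⊆ κ.target :=
      (closure_mono (Function.support_mul_subset_left _ _)).trans ht₁
    have hs : ContDiff ℝ ∞ fun z => β₁ z * g z := hβ₁.mul hg
    refine ⟨chartPull κ fun z => β₁ z * g z, contMDiff_chartPull hκ hs hc ht,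
      hasCompactSupport_chartPull hc ht, fun y => ?_, fun y w => ?_⟩
    · by_cases hy : y ∈ κ.source
      · rw [chartPull_of_mem _ hy, chartPull_of_mem _ hy, ← hFf y hy, mul_comm (F _), ← mul_sub,
          abs_mul, abs_of_nonneg β₁.nonneg, mul_comm]
        exact mul_le_mul_of_nonneg_right (hgF _) β₁.nonneg
      · simp [chartPull_of_notMem _ hy]
    · by_cases hy : y ∈ κ.source
      · rw [vdiff_chartPull_of_mem hκ hs hy, vdiff_chartPull_of_mem hκ hβ₁ hy,
          chartPull_of_mem _ hy, chartPull_of_mem _ hy, ← hFf y hy,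
          fderiv_fun_mul (hβ₁.differentiable (by simp) _) (hg.differentiable (by simp) _)]
        set u := vdiff E κ y w
        simp only [add_apply, smul_apply, smul_eq_mul]
        -- One factor 2 is the Lipschitz constant of `g`, the other the norm bound for the
        -- differential of `κ`.
        have h1 : |fderiv ℝ g (κ y) u| ≤ 4 * ‖w‖ := by
          refine (ContinuousLinearMap.le_of_opNorm_le _ (norm_fderiv_le_of_lipschitz ℝ hgL)
            _).trans ?_
          have := hb y hy w
          change 2 * ‖u‖ ≤ _
          linarith
        have h2 := hbound y hy w
        have h3 := β₁.nonneg (x := κ y)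
        calc _ = |β₁ (κ y) * fderiv ℝ g (κ y) u + (g (κ y) - F (κ y)) * fderiv ℝ β₁ (κ y) u| := by
              congr 1; ring
          _ ≤ β₁ (κ y) * (4 * ‖w‖) + δ * (b₂ (κ y) * ‖w‖) := by
              refine (abs_add_le _ _).trans (add_le_add ?_ ?_)
              · rw [abs_mul, abs_of_nonneg h3]
                exact mul_le_mul_of_nonneg_left h1 h3
              · rw [abs_mul]
                exact mul_le_mul (hgF _) h2 (abs_nonneg _) hδ.le
          _ = _ := by ring
      · rw [vdiff_chartPull_of_notMem hc ht hy,
          vdiff_chartPull_of_notMem β₁.hasCompactSupport ht₁ hy, chartPull_of_notMem _ hy,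
          chartPull_of_notMem _ hy]
        simp

/-- A Lipschitz function on a Riemannian manifold has smooth approximations with bounded
differential near a compact set. -/
theorem hasSmoothing_of_isCompact {f : M → ℝ} (hf : LipschitzWith 1 f) {s : Set M}
    (hs : IsCompact s) : HasSmoothing E f s :=
  hs.induction_on (hasSmoothing_empty f)
    (fun _ _ hst ⟨φ, η, h, hp, ha⟩ => ⟨φ, η, h, fun x hx => hp x (hst hx), ha⟩)
    (fun _ _ => HasSmoothing.union) fun x _ => by
      obtain ⟨s, hs, h⟩ := exists_hasSmoothing_nhds (E := E) hf x
      exact ⟨s, mem_nhdsWithin_of_mem_nhds hs, h⟩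

end

end Higson
end

/-! ### Differentiation under an integral with a manifold parameter. -/

noncomputable section

namespace Higson

section parametric

open MeasureTheory Set

variable {E' : Type*} [NormedAddCommGroup E'] [NormedSpace ℝ E']
  {T : Type*} [TopologicalSpace T] [ChartedSpace E' T] [IsManifold 𝓘(ℝ, E') ∞ T]
  {E : Type*} [NormedAddCommGroup E] [NormedSpace ℝ E]
  {u : T → E → ℝ} {O : Set E}

theorem contMDiffOn_fderiv_param (hO : IsOpen O)
    (hu : ContMDiffOn (𝓘(ℝ, E').prod 𝓘(ℝ, E)) 𝓘(ℝ, ℝ) ∞ (Function.uncurry u) (univ ×ˢ O)) :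
    ContMDiffOn (𝓘(ℝ, E').prod 𝓘(ℝ, E)) 𝓘(ℝ, E →L[ℝ] ℝ) ∞
      (fun p : T × E => fderiv ℝ (u p.1) p.2) (univ ×ˢ O) := by
  rintro ⟨t₀, z₀⟩ ⟨-, hz₀⟩
  refine ContMDiffAt.contMDiffWithinAt ?_
  have h1 : ContMDiffAt (𝓘(ℝ, E').prod 𝓘(ℝ, E)) 𝓘(ℝ, ℝ) ∞ (Function.uncurry u) (t₀, z₀) :=
    hu.contMDiffAt ((isOpen_univ.prod hO).mem_nhds ⟨trivial, hz₀⟩)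
  -- The point of differentiation is included among the parameters, although the function ignores it
  -- there, so that the derivative is smooth jointly in `t` and `z`.
  have h2 : ContMDiffAt ((𝓘(ℝ, E').prod 𝓘(ℝ, E)).prod 𝓘(ℝ, E)) 𝓘(ℝ, ℝ) ∞
      (Function.uncurry fun (p : T × E) (z : E) => u p.1 z) ((t₀, z₀), z₀) :=
    ContMDiffAt.comp (f := fun q : (T × E) × E => (q.1.1, q.2)) ((t₀, z₀), z₀) h1
      ((contMDiffAt_fst.comp _ contMDiffAt_fst).prodMk contMDiffAt_snd)
  have h3 := ContMDiffAt.mfderiv (m := ∞) (fun (p : T × E) (z : E) => u p.1 z) Prod.snd h2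
    contMDiffAt_snd (by simp)
  have h4 : inTangentCoordinates 𝓘(ℝ, E) 𝓘(ℝ, ℝ) Prod.snd (fun p : T × E => u p.1 p.2)
      (fun p => mfderiv 𝓘(ℝ, E) 𝓘(ℝ, ℝ) (fun z => u p.1 z) p.2) (t₀, z₀) =
        fun p : T × E => fderiv ℝ (u p.1) p.2 :=
    (inTangentCoordinates_model_space ..).trans (funext fun p => mfderiv_eq_fderiv)
  exact h4 ▸ h3

variable [T2Space T] [MeasurableSpace T] [BorelSpace T] {μ : Measure T}
  [IsFiniteMeasureOnCompacts μ] {Q : Set T} [FiniteDimensional ℝ E]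

theorem hasFDerivAt_setIntegral_param (hO : IsOpen O) (hQ : IsCompact Q)
    (hu : ContMDiffOn (𝓘(ℝ, E').prod 𝓘(ℝ, E)) 𝓘(ℝ, ℝ) ∞ (Function.uncurry u) (univ ×ˢ O))
    {z : E} (hz : z ∈ O) :
    IntegrableOn (fun t => fderiv ℝ (u t) z) Q μ ∧
    HasFDerivAt (fun z => ∫ t in Q, u t z ∂μ) (∫ t in Q, fderiv ℝ (u t) z ∂μ) z := by
  have hQm : MeasurableSet Q := hQ.isClosed.measurableSet
  have hfin : IsFiniteMeasure (μ.restrict Q) := ⟨by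
    rw [Measure.restrict_apply_univ]; exact hQ.measure_lt_top⟩
  have hd := (contMDiffOn_fderiv_param hO hu).continuousOn
  have hc := hu.continuousOn
  have hmk : ∀ z ∈ O, ContinuousOn (fun t : T => (t, z)) Q ∧
      MapsTo (fun t : T => (t, z)) Q (univ ×ˢ O) := fun z hz =>
    ⟨by fun_prop, fun _ _ => ⟨trivial, hz⟩⟩
  have hcz : ∀ z ∈ O, ContinuousOn (fun t => u t z) Q := fun z hz =>
    hc.comp (hmk z hz).1 (hmk z hz).2
  have hdz : ∀ z ∈ O, ContinuousOn (fun t => fderiv ℝ (u t) z) Q := fun z hz =>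
    hd.comp (hmk z hz).1 (hmk z hz).2
  refine ⟨(hdz z hz).integrableOn_compact hQ, ?_⟩
  obtain ⟨r, hr, hball⟩ := Metric.nhds_basis_closedBall.mem_iff.1 (hO.mem_nhds hz)
  obtain ⟨C, hC⟩ := (hQ.prod (isCompact_closedBall z r)).exists_bound_of_continuousOn
    (hd.mono (prod_mono (subset_univ _) hball))
  refine hasFDerivAt_integral_of_dominated_of_fderiv_le (bound := fun _ => C)
    (F' := fun z t => fderiv ℝ (u t) z) (Metric.closedBall_mem_nhds z hr) ?_
    ((hcz z hz).integrableOn_compact hQ)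
    ((hdz z hz).aestronglyMeasurable_of_isCompact hQ hQm) ?_ (integrable_const C) ?_
  · filter_upwards [hO.mem_nhds hz] with y hy using
      (hcz y hy).aestronglyMeasurable_of_isCompact hQ hQm
  · filter_upwards [ae_restrict_mem hQm] with t ht y hy using hC (t, y) ⟨ht, hy⟩
  · refine .of_forall fun t y hy => DifferentiableAt.hasFDerivAt ?_
    have h1 : ContMDiffAt 𝓘(ℝ, E) 𝓘(ℝ, ℝ) ∞ (u t) y :=
      ContMDiffAt.comp (f := fun y : E => (t, y)) y
        (hu.contMDiffAt ((isOpen_univ.prod hO).mem_nhds ⟨trivial, hball hy⟩))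
        (contMDiffAt_const.prodMk contMDiffAt_id)
    exact (contMDiffAt_iff_contDiffAt.1 h1).differentiableAt (by simp)

/-- Induction on the order of differentiability: each directional derivative of the integral is the
integral of a function `fderiv ℝ (u t) z v` of the same kind, hence the generalization over `u`. -/
theorem contDiffOn_setIntegral_param (hO : IsOpen O) (hQ : IsCompact Q)
    (hu : ContMDiffOn (𝓘(ℝ, E').prod 𝓘(ℝ, E)) 𝓘(ℝ, ℝ) ∞ (Function.uncurry u) (univ ×ˢ O)) :
    ContDiffOn ℝ ∞ (fun z => ∫ t in Q, u t z ∂μ) O := by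
  rw [contDiffOn_infty]
  intro n
  induction n generalizing u with
  | zero =>
    rw [Nat.cast_zero, contDiffOn_zero]
    exact fun z hz =>
      (hasFDerivAt_setIntegral_param hO hQ hu hz).2.continuousAt.continuousWithinAt
  | succ n ih =>
    rw [Nat.cast_succ, contDiffOn_succ_iff_fderiv_of_isOpen hO]
    refine ⟨fun z hz =>
      (hasFDerivAt_setIntegral_param hO hQ hu hz).2.differentiableAt.differentiableWithinAt,
      by simp, ?_⟩
    rw [contDiffOn_clm_apply]
    intro v
    have hv : ContMDiffOn (𝓘(ℝ, E').prod 𝓘(ℝ, E)) 𝓘(ℝ, ℝ) ∞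
        (Function.uncurry fun t z => fderiv ℝ (u t) z v) (univ ×ˢ O) :=
      (contMDiffOn_fderiv_param hO hu).clm_apply contMDiffOn_const
    refine (ih hv).congr fun z hz => ?_
    obtain ⟨h1, h2⟩ := hasFDerivAt_setIntegral_param (μ := μ) hO hQ hu hz
    rw [h2.fderiv]
    exact ContinuousLinearMap.integral_apply h1 v

end parametric

end Higson
end

/-! ### Averaging over a proper action. -/

noncomputable section

namespace Higson

section average

open MeasureTheory Set

/-- The set of group elements moving a point of a compact set into another compact set is
compact. -/
theorem isCompact_setOf_inv_smul_mem {G M : Type*} [Group G] [TopologicalSpace G]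
    [IsTopologicalGroup G] [TopologicalSpace M] [MulAction G M] [ProperSMul G M]
    {K S : Set M} (hK : IsCompact K) (hS : IsCompact S) :
    IsCompact {g : G | ∃ x ∈ K, g⁻¹ • x ∈ S} := by
  have h1 := (ProperSMul.isProperMap_smul_pair (G := G) (X := M)).isCompact_preimage (hS.prod hK)
  have h2 := (h1.image continuous_fst).image (continuous_inv (G := G))
  convert h2 using 1
  ext g
  constructor
  · rintro ⟨x, hx, hg⟩
    exact ⟨g⁻¹, ⟨(g⁻¹, x), ⟨hg, hx⟩, rfl⟩, inv_inv g⟩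
  · rintro ⟨_, ⟨⟨k, x⟩, ⟨hk, hx⟩, rfl⟩, rfl⟩
    exact ⟨x, hx, by simpa using hk⟩

/-- The average of a function over a group action. -/
def average {G M : Type*} [Group G] [MulAction G M] [MeasurableSpace G] (μ : Measure G)
    (φ : M → ℝ) (x : M) : ℝ :=
  ∫ g, φ (g⁻¹ • x) ∂μ

section basic

variable {G M : Type*} [Group G] [TopologicalSpace G] [IsTopologicalGroup G]
  [MulAction G M]

theorem average_smul [MeasurableSpace G] [BorelSpace G] {μ : Measure G} [μ.IsMulLeftInvariant]
    (φ : M → ℝ) (h : G) (x : M) :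
    average μ φ (h • x) = average μ φ x := by
  unfold average
  rw [← integral_mul_left_eq_self _ h]
  simp [mul_smul]

variable [TopologicalSpace M]

theorem continuous_inv_smul_comp [ContinuousSMul G M] {φ : M → ℝ} (hφ : Continuous φ) (x : M) :
    Continuous fun g : G => φ (g⁻¹ • x) := by
  fun_prop

variable [ProperSMul G M]

theorem hasCompactSupport_inv_smul_comp {φ : M → ℝ} (hφc : HasCompactSupport φ) (x : M) :
    HasCompactSupport fun g : G => φ (g⁻¹ • x) := by
  refine HasCompactSupport.intro (isCompact_setOf_inv_smul_mem (isCompact_singleton (x := x))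
    hφc.isCompact) fun g hg => ?_
  by_contra h
  exact hg ⟨x, rfl, subset_tsupport _ h⟩

variable [MeasurableSpace G] [BorelSpace G] {μ : Measure G} [IsFiniteMeasureOnCompacts μ]

theorem integrable_inv_smul_comp {φ : M → ℝ} (hφ : Continuous φ) (hφc : HasCompactSupport φ)
    (x : M) : Integrable (fun g : G => φ (g⁻¹ • x)) μ :=
  (continuous_inv_smul_comp hφ x).integrable_of_hasCompactSupport
    (hasCompactSupport_inv_smul_comp hφc x)

theorem average_pos [μ.IsOpenPosMeasure] {φ : M → ℝ} (hφ : Continuous φ)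
    (hφc : HasCompactSupport φ) (h0 : ∀ x, 0 ≤ φ x) {x : M} (hx : 0 < φ x) :
    0 < average μ φ x :=
  (continuous_inv_smul_comp hφ x).integral_pos_of_hasCompactSupport_nonneg_nonzero
    (hasCompactSupport_inv_smul_comp hφc x) (fun g => h0 _) (x := 1) (by simpa using hx.ne')

end basic

variable {G : Type*} [TopologicalSpace G] [Group G]
  {E : Type*} [NormedAddCommGroup E] [NormedSpace ℝ E]
  {M : Type*} [TopologicalSpace M] [ChartedSpace E M] [MulAction G M]

theorem vdiff_inv_smul_comp (E' : Type*) [NormedAddCommGroup E'] [NormedSpace ℝ E']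
    [ChartedSpace E' G] [LieGroup 𝓘(ℝ, E') ∞ G] [ContMDiffSMul 𝓘(ℝ, E') 𝓘(ℝ, E) ∞ G M]
    {φ : M → ℝ} (hφ : ContMDiff 𝓘(ℝ, E) 𝓘(ℝ, ℝ) ∞ φ) (g : G) (x : M)
    (w : TangentSpace 𝓘(ℝ, E) x) :
    vdiff E (fun y => φ (g⁻¹ • y)) x w =
      vdiff E φ (g⁻¹ • x) (mfderiv 𝓘(ℝ, E) 𝓘(ℝ, E) (fun y : M => g⁻¹ • y) x w) := by
  have h3 : ContMDiff (𝓘(ℝ, E').prod 𝓘(ℝ, E)) 𝓘(ℝ, E) ∞ fun p : G × M => p.1 • p.2 :=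
    ContMDiffSMul.contMDiff_smul
  have h4 : ContMDiff 𝓘(ℝ, E) 𝓘(ℝ, E) ∞ fun y : M => g⁻¹ • y :=
    h3.comp (contMDiff_const.prodMk contMDiff_id)
  exact DFunLike.congr_fun (vdiff_eq_of_hasMFDerivAt (HasMFDerivAt.comp x
    (hasMFDerivAt_vdiff (hφ.mdifferentiable (by simp) (g⁻¹ • x)))
    (h4.mdifferentiable (by simp) x).hasMFDerivAt)) w

variable [IsTopologicalGroup G] [T2Space G] [FiniteDimensional ℝ E]
  [IsManifold 𝓘(ℝ, E) ∞ M] [ProperSMul G M]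
  [MeasurableSpace G] [BorelSpace G] {μ : Measure G} [IsFiniteMeasureOnCompacts μ]

/-- Properness localizes the integral: for `y` in a compact coordinate ball around `x`, the
integrand vanishes unless `g` lies in one compact set `Q`. Near `x` the average is therefore a
parametric integral over a fixed compact set, which may be differentiated under the integral sign.
-/
theorem average_spec (E' : Type*) [NormedAddCommGroup E'] [NormedSpace ℝ E']
    [ChartedSpace E' G] [LieGroup 𝓘(ℝ, E') ∞ G] [ContMDiffSMul 𝓘(ℝ, E') 𝓘(ℝ, E) ∞ G M]
    {φ : M → ℝ} (hφ : ContMDiff 𝓘(ℝ, E) 𝓘(ℝ, ℝ) ∞ φ)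
    (hφc : HasCompactSupport φ) (x : M) :
    ContMDiffAt 𝓘(ℝ, E) 𝓘(ℝ, ℝ) ∞ (average μ φ) x ∧ ∀ w,
      Integrable (fun g : G => vdiff E (fun y => φ (g⁻¹ • y)) x w) μ ∧
      vdiff E (average μ φ) x w = ∫ g : G, vdiff E (fun y => φ (g⁻¹ • y)) x w ∂μ := by
  set e := chartAt E x with he
  have hxe : x ∈ e.source := mem_chart_source E x
  obtain ⟨r, hr, hball⟩ := Metric.nhds_basis_closedBall.mem_iff.1
    (e.open_target.mem_nhds (e.map_source hxe))
  have : ProperSpace E := FiniteDimensional.proper_real E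
  set O := Metric.ball (e x) r with hO
  have hOt : O ⊆ e.target := Metric.ball_subset_closedBall.trans hball
  have hxO : e x ∈ O := Metric.mem_ball_self hr
  have hK : IsCompact (e.symm '' Metric.closedBall (e x) r) :=
    (isCompact_closedBall _ _).image_of_continuousOn (e.continuousOn_symm.mono hball)
  have hQ := isCompact_setOf_inv_smul_mem (G := G) hK hφc.isCompact
  set Q := {g : G | ∃ y ∈ e.symm '' Metric.closedBall (e x) r, g⁻¹ • y ∈ tsupport φ}
  let u : G → E → ℝ := fun g z => φ (g⁻¹ • e.symm z)
  have huQ : ∀ g ∉ Q, ∀ z ∈ O, u g z = 0 := fun g hg z hz => by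
    by_contra h
    exact hg ⟨e.symm z, ⟨z, Metric.ball_subset_closedBall hz, rfl⟩,
      subset_tsupport _ (show φ (g⁻¹ • e.symm z) ≠ 0 from h)⟩
  have hu : ContMDiffOn (𝓘(ℝ, E').prod 𝓘(ℝ, E)) 𝓘(ℝ, ℝ) ∞ (Function.uncurry u) (univ ×ˢ O) := by
    have h1 : ContMDiffOn (𝓘(ℝ, E').prod 𝓘(ℝ, E)) 𝓘(ℝ, E) ∞
        (fun p : G × E => e.symm p.2) (univ ×ˢ O) :=
      (contMDiffOn_chart_symm (I := 𝓘(ℝ, E)) (x := x)).comp contMDiff_snd.contMDiffOn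
        fun p hp => hOt hp.2
    have h2 : ContMDiffOn (𝓘(ℝ, E').prod 𝓘(ℝ, E)) 𝓘(ℝ, E') ∞
        (fun p : G × E => p.1⁻¹) (univ ×ˢ O) :=
      ((contMDiff_inv 𝓘(ℝ, E') ∞).comp contMDiff_fst).contMDiffOn
    have h3 : ContMDiff (𝓘(ℝ, E').prod 𝓘(ℝ, E)) 𝓘(ℝ, E) ∞ fun p : G × M => p.1 • p.2 :=
      ContMDiffSMul.contMDiff_smul
    exact hφ.comp_contMDiffOn (h3.comp_contMDiffOn (h2.prodMk h1))
  have hN : e.source ∩ e ⁻¹' O ∈ nhds x := Filter.inter_mem (e.open_source.mem_nhds hxe)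
    ((e.continuousAt hxe).preimage_mem_nhds (Metric.isOpen_ball.mem_nhds hxO))
  have hav : average μ φ =ᶠ[nhds x] (fun z => ∫ g in Q, u g z ∂μ) ∘ e := by
    filter_upwards [hN] with y hy
    rw [Function.comp_apply, setIntegral_eq_integral_of_forall_compl_eq_zero
      fun g hg => huQ g hg _ hy.2]
    simp only [u, e.left_inv hy.1, average]
  have hg : ∀ g : G, (fun y => φ (g⁻¹ • y)) =ᶠ[nhds x] u g ∘ e := fun g => by
    filter_upwards [hN] with y hy
    simp only [u, Function.comp_apply, e.left_inv hy.1]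
  have hed : ContMDiffAt 𝓘(ℝ, E) 𝓘(ℝ, E) ∞ e x :=
    (contMDiffOn_chart (I := 𝓘(ℝ, E)) (x := x)).contMDiffAt (e.open_source.mem_nhds hxe)
  have hed' := hasMFDerivAt_vdiff (hed.mdifferentiableAt (by simp))
  obtain ⟨hint, hderiv⟩ := hasFDerivAt_setIntegral_param (μ := μ) Metric.isOpen_ball hQ hu hxO
  have hug : ∀ g, DifferentiableAt ℝ (u g) (e x) := fun g => by
    have h1 : ContMDiffAt 𝓘(ℝ, E) 𝓘(ℝ, ℝ) ∞ (u g) (e x) :=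
      ContMDiffAt.comp (f := fun y : E => (g, y)) (e x)
        (hu.contMDiffAt ((isOpen_univ.prod Metric.isOpen_ball).mem_nhds ⟨trivial, hxO⟩))
        (contMDiffAt_const.prodMk contMDiffAt_id)
    exact (contMDiffAt_iff_contDiffAt.1 h1).differentiableAt (by simp)
  have hvg : ∀ (g : G) w, vdiff E (fun y => φ (g⁻¹ • y)) x w =
      fderiv ℝ (u g) (e x) (vdiff E e x w) := fun g w => by
    rw [vdiff_eq_of_hasMFDerivAt ((HasMFDerivAt.comp x (hug g).hasFDerivAt.hasMFDerivAt
      hed').congr_of_eventuallyEq (hg g))]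
    rfl
  have hv0 : ∀ g ∉ Q, fderiv ℝ (u g) (e x) = 0 := fun g hgQ => by
    have h1 : u g =ᶠ[nhds (e x)] fun _ => 0 := by
      filter_upwards [Metric.isOpen_ball.mem_nhds hxO] with z hz using huQ g hgQ z hz
    rw [h1.fderiv_eq]
    simp
  refine ⟨?_, fun w => ⟨?_, ?_⟩⟩
  · refine ContMDiffAt.congr_of_eventuallyEq ?_ hav
    have h1 := (contDiffOn_setIntegral_param (μ := μ) Metric.isOpen_ball hQ hu).contDiffAt
      (Metric.isOpen_ball.mem_nhds hxO)
    exact h1.contMDiffAt.comp x hed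
  · simp only [hvg]
    refine IntegrableOn.integrable_of_forall_notMem_eq_zero (s := Q) ?_ fun g hg => ?_
    · exact hint.apply_continuousLinearMap _
    · rw [hv0 g hg]; rfl
  · rw [vdiff_eq_of_hasMFDerivAt ((HasMFDerivAt.comp x hderiv.hasMFDerivAt
      hed').congr_of_eventuallyEq hav)]
    simp only [hvg]
    rw [← setIntegral_eq_integral_of_forall_compl_eq_zero (s := Q)
      (f := fun g => fderiv ℝ (u g) (e x) (vdiff E e x w)) fun g hg => by rw [hv0 g hg]; rfl]
    exact ContinuousLinearMap.integral_apply hint _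

theorem contMDiff_average (E' : Type*) [NormedAddCommGroup E'] [NormedSpace ℝ E']
    [ChartedSpace E' G] [LieGroup 𝓘(ℝ, E') ∞ G] [ContMDiffSMul 𝓘(ℝ, E') 𝓘(ℝ, E) ∞ G M]
    {φ : M → ℝ} (hφ : ContMDiff 𝓘(ℝ, E) 𝓘(ℝ, ℝ) ∞ φ)
    (hφc : HasCompactSupport φ) : ContMDiff 𝓘(ℝ, E) 𝓘(ℝ, ℝ) ∞ (average μ φ) := fun x =>
  (average_spec E' hφ hφc x).1

end average

end Higson
end

/-! ### Invariant smoothing. -/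

noncomputable section

namespace Higson

section invariantSmoothing

open MeasureTheory Set

variable {G : Type*} [TopologicalSpace G] [T2Space G] [Group G] [IsTopologicalGroup G]
  {E : Type*} [NormedAddCommGroup E] [NormedSpace ℝ E] [FiniteDimensional ℝ E]
  {M : Type*} [TopologicalSpace M] [ChartedSpace E M] [IsManifold 𝓘(ℝ, E) ∞ M]
  [RiemannianBundle (fun x : M => TangentSpace 𝓘(ℝ, E) x)]
  [MulAction G M] [ProperSMul G M]

/-- The averaged smoothing of an invariant function is close to it, with bounded differential. -/
theorem average_smoothing_bound (E' : Type*) [NormedAddCommGroup E'] [NormedSpace ℝ E']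
    [ChartedSpace E' G] [LieGroup 𝓘(ℝ, E') ∞ G] [ContMDiffSMul 𝓘(ℝ, E') 𝓘(ℝ, E) ∞ G M]
    [MeasurableSpace G] [BorelSpace G] {μ : Measure G} [IsFiniteMeasureOnCompacts μ]
    (hisom : ∀ (g : G) (x : M) (v : TangentSpace 𝓘(ℝ, E) x),
      ‖mfderiv 𝓘(ℝ, E) 𝓘(ℝ, E) (fun y : M => g • y) x v‖ = ‖v‖)
    {f φ η P : M → ℝ} (hinv : ∀ (g : G) x, f (g • x) = f x) (hφ : IsBumpPair E φ η) {δ : ℝ}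
    (hP : IsBumpApprox E f φ η δ P) {x : M} (hx : 0 < average μ φ x) :
    |average μ P x / average μ φ x - f x| ≤ δ ∧
      ∀ w, |vdiff E (fun y => average μ P y / average μ φ y) x w| * average μ φ x ≤
        (4 * average μ φ x + 2 * δ * average μ η x) * ‖w‖ := by
  have hPi := integrable_inv_smul_comp (μ := μ) hP.smooth.continuous hP.compact x
  have hφi := integrable_inv_smul_comp (μ := μ) hφ.smooth.continuous hφ.compact x
  have hηi := integrable_inv_smul_comp (μ := μ) hφ.smooth'.continuous hφ.compact' x
  have h1 : |average μ P x - f x * average μ φ x| ≤ δ * average μ φ x := by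
    have h2 : average μ P x - f x * average μ φ x =
        ∫ g : G, (P (g⁻¹ • x) - f x * φ (g⁻¹ • x)) ∂μ := by
      rw [integral_sub hPi (hφi.const_mul _), integral_const_mul]
      rfl
    have h3 : δ * average μ φ x = ∫ g : G, δ * φ (g⁻¹ • x) ∂μ := by
      rw [integral_const_mul]
      rfl
    rw [h2, h3, ← Real.norm_eq_abs]
    refine norm_integral_le_of_norm_le (hφi.const_mul δ) (.of_forall fun g => ?_)
    rw [Real.norm_eq_abs, ← hinv g⁻¹ x]
    exact hP.approx _
  have hF : |average μ P x / average μ φ x - f x| ≤ δ := by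
    rwa [div_sub' hx.ne', abs_div, abs_of_pos hx, div_le_iff₀ hx, mul_comm (average μ φ x)]
  refine ⟨hF, fun w => ?_⟩
  set F : M → ℝ := fun y => average μ P y / average μ φ y with hFdef
  have hN := contMDiff_average (μ := μ) E' hP.smooth hP.compact
  have hD := contMDiff_average (μ := μ) E' hφ.smooth hφ.compact
  have hFs : ContMDiffAt 𝓘(ℝ, E) 𝓘(ℝ, ℝ) ∞ F x := hN.contMDiffAt.div₀ hD.contMDiffAt hx.ne'
  have hne : ∀ᶠ y in nhds x, average μ φ y ≠ 0 :=
    hD.continuous.continuousAt.eventually_ne hx.ne'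
  have hmul : vdiff E (average μ P) x =
      F x • vdiff E (average μ φ) x + average μ φ x • vdiff E F x := by
    refine vdiff_eq_of_hasMFDerivAt (HasMFDerivAt.congr_of_eventuallyEq (f := F * average μ φ)
      ((hasMFDerivAt_vdiff (hFs.mdifferentiableAt (by simp))).mul
        (hasMFDerivAt_vdiff (hD.contMDiffAt.mdifferentiableAt (by simp)))) ?_)
    filter_upwards [hne] with y hy
    simp [F, hy]
  obtain ⟨hPi', hP'⟩ := (average_spec (μ := μ) E' hP.smooth hP.compact x).2 w
  obtain ⟨hφi', hφ'⟩ := (average_spec (μ := μ) E' hφ.smooth hφ.compact x).2 w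
  -- The quotient rule without division: `dF` times the average of `φ` is the average of `dP` minus
  -- `F x` times the average of `dφ`. Replacing `F x` by `f x` in the integrand costs a second `δ *
  -- η`, hence the factor `2 * δ`.
  have h4 : vdiff E F x w * average μ φ x =
      ∫ g : G, (vdiff E (fun y => P (g⁻¹ • y)) x w -
        F x * vdiff E (fun y => φ (g⁻¹ • y)) x w) ∂μ := by
    rw [integral_sub hPi' (hφi'.const_mul _), integral_const_mul, ← hP', ← hφ', hmul]
    simp only [add_apply, smul_apply, smul_eq_mul]
    ring
  have h5 : (4 * average μ φ x + 2 * δ * average μ η x) * ‖w‖ =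
      ∫ g : G, (4 * φ (g⁻¹ • x) + 2 * δ * η (g⁻¹ • x)) * ‖w‖ ∂μ := by
    rw [integral_mul_const, integral_add (hφi.const_mul _) (hηi.const_mul _), integral_const_mul,
      integral_const_mul]
    rfl
  rw [← abs_of_pos hx, ← abs_mul, abs_of_pos hx, h4, h5, ← Real.norm_eq_abs]
  refine norm_integral_le_of_norm_le
    (((hφi.const_mul 4).add (hηi.const_mul (2 * δ))).mul_const ‖w‖) (.of_forall fun g => ?_)
  rw [vdiff_inv_smul_comp E' hP.smooth, vdiff_inv_smul_comp E' hφ.smooth, Real.norm_eq_abs]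
  have hn := hisom g⁻¹ x w
  set w' : TangentSpace 𝓘(ℝ, E) (g⁻¹ • x) := mfderiv 𝓘(ℝ, E) 𝓘(ℝ, E) (fun y : M => g⁻¹ • y) x w
  have h6 := hP.approx' (g⁻¹ • x) w'
  have h7 := hφ.bound (g⁻¹ • x) w'
  rw [hn, hinv] at h6
  rw [hn] at h7
  have h8 : |F x - f x| ≤ δ := hF
  calc |vdiff E P (g⁻¹ • x) w' - F x * vdiff E φ (g⁻¹ • x) w'|
      = |(vdiff E P (g⁻¹ • x) w' - f x * vdiff E φ (g⁻¹ • x) w') -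
          (F x - f x) * vdiff E φ (g⁻¹ • x) w'| := by congr 1; ring
    _ ≤ (4 * φ (g⁻¹ • x) + δ * η (g⁻¹ • x)) * ‖w‖ + δ * (η (g⁻¹ • x) * ‖w‖) := by
        refine (abs_sub _ _).trans (add_le_add h6 ?_)
        rw [abs_mul]
        exact mul_le_mul h8 h7 (abs_nonneg _) ((abs_nonneg _).trans h8)
    _ = _ := by ring

end invariantSmoothing

section

open MeasureTheory Set

/-- An invariant Lipschitz function can be approximated, near the orbits of a compact set, by smooth
invariant functions with bounded differential. -/
theorem exists_invariant_smoothing {G : Type*} [TopologicalSpace G] [T2Space G] [Group G]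
    [IsTopologicalGroup G] [LocallyCompactSpace G]
    {E : Type*} [NormedAddCommGroup E] [NormedSpace ℝ E] [FiniteDimensional ℝ E]
    {M : Type*} [EMetricSpace M] [ChartedSpace E M] [IsManifold 𝓘(ℝ, E) ∞ M]
    [RiemannianBundle (fun x : M => TangentSpace 𝓘(ℝ, E) x)]
    [IsContMDiffRiemannianBundle 𝓘(ℝ, E) ∞ E (fun x : M => TangentSpace 𝓘(ℝ, E) x)]
    [IsRiemannianManifold 𝓘(ℝ, E) M]
    [MulAction G M] [ProperSMul G M]
    (E' : Type*) [NormedAddCommGroup E'] [NormedSpace ℝ E']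
    [ChartedSpace E' G] [LieGroup 𝓘(ℝ, E') ∞ G] [ContMDiffSMul 𝓘(ℝ, E') 𝓘(ℝ, E) ∞ G M]
    (hisom : ∀ (g : G) (x : M) (v : TangentSpace 𝓘(ℝ, E) x),
      ‖mfderiv 𝓘(ℝ, E) 𝓘(ℝ, E) (fun y : M => g • y) x v‖ = ‖v‖)
    {f : M → ℝ} (hf : LipschitzWith 1 f) (hinv : ∀ (g : G) x, f (g • x) = f x)
    {L : Set M} (hL : IsCompact L) {δ : ℝ} (hδ : 0 < δ) :
    ∃ (Ω : Set M) (F : M → ℝ), IsOpen Ω ∧ (∀ (g : G), ∀ x ∈ Ω, g • x ∈ Ω) ∧ L ⊆ Ω ∧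
      (∀ (g : G) x, F (g • x) = F x) ∧ ContMDiffOn 𝓘(ℝ, E) 𝓘(ℝ, ℝ) ∞ F Ω ∧
      ∀ x ∈ Ω, |F x - f x| ≤ δ ∧ ∀ w, |vdiff E F x w| ≤ 5 * ‖w‖ := by
  borelize G
  let μ : Measure G := Measure.haar
  obtain ⟨φ, η, hφ, hpos, happ⟩ := hasSmoothing_of_isCompact (E := E) hf hL
  have hD := contMDiff_average (μ := μ) E' hφ.smooth hφ.compact
  have hH := contMDiff_average (μ := μ) E' hφ.smooth' hφ.compact'
  obtain ⟨c, hc, hcL⟩ := hL.exists_forall_le' hD.continuous.continuousOn fun x hx =>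
    average_pos (μ := μ) hφ.smooth.continuous hφ.compact hφ.nonneg (hpos x hx)
  obtain ⟨B, hB⟩ := hL.exists_bound_of_continuousOn hH.continuous.continuousOn
  -- With this tolerance, where the averages satisfy `φ > c / 2` and `η < |B| + 1`, the error term
  -- is at most `c / 2`, so it adds at most 1 to the constant 4.
  obtain ⟨P, hP⟩ := happ (min δ (c / (4 * (|B| + 1)))) (by positivity)
  refine ⟨{x | c / 2 < average μ φ x} ∩ {x | average μ η x < |B| + 1},
    fun x => average μ P x / average μ φ x,
    (isOpen_lt continuous_const hD.continuous).inter (isOpen_lt hH.continuous continuous_const),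
    fun g x hx => ?_, fun x hx => ⟨?_, ?_⟩, fun g x => ?_, fun x hx => ?_, fun x hx => ?_⟩
  · simpa only [mem_inter_iff, mem_ofPred_eq, average_smul] using hx
  · exact (half_lt_self hc).trans_le (hcL x hx)
  · have h1 := (le_abs_self _).trans ((hB x hx).trans (le_abs_self B))
    exact h1.trans_lt (lt_add_one _)
  · simp only [average_smul]
  · exact ((contMDiff_average (μ := μ) E' hP.smooth hP.compact).contMDiffAt.div₀ hD.contMDiffAt
      ((half_pos hc).trans hx.1).ne').contMDiffWithinAt
  · have hx0 : 0 < average μ φ x := (half_pos hc).trans hx.1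
    obtain ⟨h1, h2⟩ := average_smoothing_bound (μ := μ) E' hisom hinv hφ hP hx0
    refine ⟨h1.trans (min_le_left _ _), fun w => ?_⟩
    have h3 : 0 ≤ average μ η x := integral_nonneg fun g => hφ.nonneg' _
    have h4 : 2 * min δ (c / (4 * (|B| + 1))) * average μ η x ≤ average μ φ x := by
      calc _ ≤ 2 * (c / (4 * (|B| + 1))) * (|B| + 1) := by
            gcongr
            · exact min_le_right _ _
            · exact hx.2.le
        _ = c / 2 := by field_simp; norm_num
        _ ≤ _ := hx.1.le
    refine le_of_mul_le_mul_right ?_ hx0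
    calc _ ≤ _ := h2 w
      _ ≤ (4 * average μ φ x + average μ φ x) * ‖w‖ := by gcongr
      _ = _ := by ring

end

end Higson
end

/-! ### The Hopf–Rinow theorem. -/

noncomputable section

namespace Higson

section hopfRinow

open Set Manifold
open scoped NNReal ENNReal

variable {E : Type*} [NormedAddCommGroup E] [NormedSpace ℝ E]
  {M : Type*} [EMetricSpace M] [ChartedSpace E M]
  [RiemannianBundle (fun x : M => TangentSpace 𝓘(ℝ, E) x)]

variable (E) in
/-- A Riemannian manifold is a length space. -/
theorem exists_edist_lt_edist_lt [IsRiemannianManifold 𝓘(ℝ, E) M] {x y : M} {a b : ℝ≥0∞}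
    (ha : 0 < a) (hb : 0 < b) (h : edist x y < a + b) :
    ∃ z, edist x z < a ∧ edist z y < b := by
  rcases lt_or_ge (edist x y) a with hxy | hxy
  · exact ⟨y, hxy, by simpa using hb⟩
  rw [IsRiemannianManifold.out (I := 𝓘(ℝ, E)) x y] at h
  obtain ⟨γ, h0, h1, hγ, hlen⟩ := exists_lt_of_riemannianEDist_lt h
  -- The point sought is where a nearly minimal path first known to reach distance `a'` from `x`: it
  -- is closer than `a` to `x`, and the remaining path is shorter than `b`.
  obtain ⟨a', ha', ha'a⟩ : ∃ a', pathELength 𝓘(ℝ, E) γ 0 1 - b < a' ∧ a' < a := by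
    refine exists_between ?_
    rcases le_total b (pathELength 𝓘(ℝ, E) γ 0 1) with hle | hle
    · exact ENNReal.sub_lt_of_lt_add hle hlen
    · rwa [tsub_eq_zero_of_le hle]
  have hlt : pathELength 𝓘(ℝ, E) γ 0 1 < a' + b := by
    rcases eq_or_ne b ⊤ with rfl | hb'
    · simpa using hlen.trans_le le_top
    · exact not_le.1 fun hle => absurd ha' (not_lt.2 (ENNReal.le_sub_of_add_le_right hb' hle))
  have hcont : ContinuousOn (fun t => edist x (γ t)) (Icc 0 1) :=
    (continuous_const.edist continuous_id).comp_continuousOn hγ.continuousOn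
  obtain ⟨t, ht, hta⟩ := intermediate_value_Icc zero_le_one hcont
    (show a' ∈ Icc (edist x (γ 0)) (edist x (γ 1)) by
      rw [h0, h1, edist_self]
      exact ⟨bot_le, ha'a.le.trans hxy⟩)
  have hta : edist x (γ t) = a' := hta
  refine ⟨γ t, hta.trans_lt ha'a, ?_⟩
  have e1 : a' ≤ pathELength 𝓘(ℝ, E) γ 0 t := by
    rw [← hta, IsRiemannianManifold.out (I := 𝓘(ℝ, E)) x]
    exact riemannianEDist_le_pathELength (hγ.mono (Icc_subset_Icc_right ht.2)) h0 rfl ht.1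
  have e2 : edist (γ t) y ≤ pathELength 𝓘(ℝ, E) γ t 1 := by
    rw [IsRiemannianManifold.out (I := 𝓘(ℝ, E)) _ y]
    exact riemannianEDist_le_pathELength (hγ.mono (Icc_subset_Icc_left ht.1)) rfl h1 ht.2
  refine e2.trans_lt ?_
  by_contra hcon
  rw [not_lt] at hcon
  have := (add_le_add e1 hcon).trans_eq (pathELength_add ht.1 ht.2)
  exact absurd hlt (not_lt.2 this)

variable (E) in
/-- The Hopf–Rinow theorem: closed balls of finite radius are compact. -/
theorem isCompact_closedEBall_of_complete [IsRiemannianManifold 𝓘(ℝ, E) M] [CompleteSpace M]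
    [LocallyCompactSpace M] (x : M) (r : ℝ≥0) : IsCompact {y : M | edist x y ≤ r} := by
  have hclosed : ∀ r : ℝ≥0, IsClosed {y : M | edist x y ≤ r} := fun r =>
    isClosed_le (continuous_const.edist continuous_id) continuous_const
  let S : Set ℝ≥0 := {r | IsCompact {y : M | edist x y ≤ r}}
  have hmono : ∀ {r s : ℝ≥0}, r ≤ s → s ∈ S → r ∈ S := fun {r s} hrs hs =>
    IsCompact.of_isClosed_subset hs (hclosed r) fun y hy =>
      (show edist x y ≤ r from hy).trans (by exact_mod_cast hrs)
  have h0 : (0 : ℝ≥0) ∈ S := by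
    have : {y : M | edist x y ≤ (0 : ℝ≥0)} = {x} := by
      ext y
      simp [eq_comm]
    simp only [S, mem_ofPred_eq, this, isCompact_singleton]
  by_contra hr
  have hbdd : ∀ s ∈ S, s ≤ r := fun s hs => by
    by_contra hlt
    exact hr (hmono (not_le.1 hlt).le hs)
  have hB : BddAbove S := ⟨r, hbdd⟩
  set R := sSup S with hR
  -- The supremum is attained: by the length-space property each point of the ball of radius `R` is
  -- within `δ / 2` of a compact ball of slightly smaller radius, so the former is totally bounded,
  -- and it is complete.
  have hRS : R ∈ S := by
    rcases eq_or_lt_of_le (zero_le : 0 ≤ R) with hR0 | hR0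
    · rwa [← hR0]
    refine isCompact_iff_totallyBounded_isComplete.2
      ⟨EMetric.totallyBounded_iff.2 fun ε hε => ?_, (hclosed R).isComplete⟩
    obtain ⟨δ, hδ, hδε⟩ := ENNReal.lt_iff_exists_nnreal_btwn.1 hε
    have hδ : 0 < δ := by exact_mod_cast hδ
    obtain ⟨s, hsS, hs⟩ := exists_lt_of_lt_csSup ⟨0, h0⟩
      (show max (R - δ / 2) 0 < sSup S by
        rw [← hR, max_lt_iff]
        exact ⟨tsub_lt_self hR0 (by positivity), hR0⟩)
    rw [max_lt_iff] at hs
    have hs1 : R < s + δ / 2 := lt_add_of_tsub_lt_right hs.1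
    obtain ⟨t, ht, hcov⟩ := EMetric.totallyBounded_iff.1
      (show IsCompact {y : M | edist x y ≤ s} from hsS).totallyBounded ((δ / 2 : ℝ≥0) : ℝ≥0∞)
        (by exact_mod_cast half_pos hδ)
    refine ⟨t, ht, fun y hy => ?_⟩
    obtain ⟨z, hxz, hzy⟩ := exists_edist_lt_edist_lt E (x := x) (y := y) (a := s)
      (b := (δ / 2 : ℝ≥0)) (by exact_mod_cast hs.2) (by exact_mod_cast half_pos hδ)
      (lt_of_le_of_lt hy (by exact_mod_cast hs1))
    obtain ⟨w, hw, hwz⟩ := mem_iUnion₂.1 (hcov (show edist x z ≤ s from hxz.le))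
    refine mem_iUnion₂.2 ⟨w, hw, ?_⟩
    rw [Metric.mem_eball] at hwz ⊢
    calc edist y w ≤ edist y z + edist z w := edist_triangle _ _ _
      _ < (δ / 2 : ℝ≥0) + (δ / 2 : ℝ≥0) := ENNReal.add_lt_add (by rwa [edist_comm]) hwz
      _ = δ := by rw [← ENNReal.coe_add, add_halves]
      _ ≤ ε := hδε.le
  obtain ⟨K, hK, hRK⟩ := exists_compact_superset (show IsCompact {y : M | edist x y ≤ R} from hRS)
  obtain ⟨δ, hδ, hthick⟩ :=
    (show IsCompact {y : M | edist x y ≤ R} from hRS).exists_thickening_subset_open isOpen_interior hRK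
  lift δ to ℝ≥0 using hδ.le
  have hδ : 0 < δ := by exact_mod_cast hδ
  -- A compact neighbourhood of the ball of radius `R` contains its `δ`-thickening, which by the
  -- length-space property contains the ball of radius `R + δ / 2`; this contradicts maximality of
  -- `R`.
  have hmem : R + δ / 2 ∈ S := by
    refine hK.of_isClosed_subset (hclosed _) fun y hy => interior_subset (hthick ?_)
    have hy : edist x y ≤ (R + δ / 2 : ℝ≥0) := hy
    rw [Metric.mem_thickening_iff_exists_edist_lt]
    rw [ENNReal.ofReal_coe_nnreal]
    rcases eq_or_lt_of_le (zero_le : 0 ≤ R) with hR0 | hR0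
    · refine ⟨x, by simp, ?_⟩
      rw [edist_comm]
      refine hy.trans_lt ?_
      rw [← hR0, zero_add]
      exact_mod_cast half_lt_self hδ
    · obtain ⟨z, hxz, hzy⟩ := exists_edist_lt_edist_lt E (x := x) (y := y) (a := R) (b := δ)
        (by exact_mod_cast hR0) (by exact_mod_cast hδ) (hy.trans_lt (by
          exact_mod_cast add_lt_add_right (half_lt_self hδ) R))
      exact ⟨z, hxz.le, by rwa [edist_comm]⟩
  have := le_csSup hB hmem
  rw [← hR] at this
  exact absurd this (not_le.2 (lt_add_of_pos_right R (half_pos hδ)))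

end hopfRinow

end Higson
end

/-! ### The distance to an orbit as an exhaustion of the orbit space. -/

noncomputable section

namespace Higson

section exhaustion

open Set Manifold

variable {G : Type*} [TopologicalSpace G] [Group G]
  {E : Type*} [NormedAddCommGroup E] [NormedSpace ℝ E]
  {M : Type*} [EMetricSpace M] [ChartedSpace E M]
  [RiemannianBundle (fun x : M => TangentSpace 𝓘(ℝ, E) x)] [IsRiemannianManifold 𝓘(ℝ, E) M]
  [MulAction G M]

theorem contMDiff_const_smul' (E' : Type*) [NormedAddCommGroup E'] [NormedSpace ℝ E']
    [ChartedSpace E' G] [ContMDiffSMul 𝓘(ℝ, E') 𝓘(ℝ, E) ∞ G M] (g : G) :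
    ContMDiff 𝓘(ℝ, E) 𝓘(ℝ, E) ∞ fun y : M => g • y :=
  (ContMDiffSMul.contMDiff_smul (I := 𝓘(ℝ, E')) (I' := 𝓘(ℝ, E)) (n := ∞) (G := G) (M := M)).comp
    (contMDiff_const.prodMk contMDiff_id)

/-- An action whose differentials are isometric preserves the Riemannian distance. -/
theorem edist_smul_smul_le {g : G}
    (hsmooth : ContMDiff 𝓘(ℝ, E) 𝓘(ℝ, E) ∞ fun y : M => g • y)
    (hisom : ∀ (x : M) (v : TangentSpace 𝓘(ℝ, E) x),
      ‖mfderiv 𝓘(ℝ, E) 𝓘(ℝ, E) (fun y : M => g • y) x v‖ = ‖v‖) (x y : M) :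
    edist (g • x) (g • y) ≤ edist x y := by
  refine le_of_forall_gt fun r hr => ?_
  rw [IsRiemannianManifold.out (I := 𝓘(ℝ, E)) x y] at hr
  obtain ⟨γ, h0, h1, hγ, hlen⟩ := exists_lt_of_riemannianEDist_lt hr
  rw [IsRiemannianManifold.out (I := 𝓘(ℝ, E)) (g • x) (g • y)]
  have hγ' : ContMDiffOn 𝓘(ℝ, ℝ) 𝓘(ℝ, E) 1 ((fun y : M => g • y) ∘ γ) (Icc 0 1) :=
    (hsmooth.of_le (by simp)).comp_contMDiffOn hγ
  refine (riemannianEDist_le_pathELength hγ' (by simp [h0]) (by simp [h1]) zero_le_one).trans_lt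
    (lt_of_le_of_lt ?_ hlen)
  rw [pathELength_eq_lintegral_mfderiv_Ioo, pathELength_eq_lintegral_mfderiv_Ioo]
  refine MeasureTheory.setLIntegral_mono' measurableSet_Ioo fun t ht => ?_
  have hd := HasMFDerivAt.comp t
    (hsmooth.mdifferentiable (by simp) (γ t)).hasMFDerivAt
    ((hγ.contMDiffAt (Icc_mem_nhds ht.1 ht.2)).mdifferentiableAt one_ne_zero).hasMFDerivAt
  rw [hd.mfderiv]
  exact enorm_le_iff_norm_le.2 (hisom (γ t) _).le

/-- The orbit space of a proper isometric action is exhausted by an invariant distance function. -/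
theorem exists_invariant_lipschitz_exhaustion [FiniteDimensional ℝ E] [CompleteSpace M]
    [ProperSMul G M] [ConnectedSpace (MulAction.orbitRel.Quotient G M)]
    (hdist : ∀ (g : G) (x y : M), edist (g • x) (g • y) ≤ edist x y) :
    ∃ f : M → ℝ, LipschitzWith 1 f ∧ (∀ x, 0 ≤ f x) ∧ (∀ (g : G) x, f (g • x) = f x) ∧
      ∀ R : ℝ, ∃ L : Set M, IsCompact L ∧ ∀ x, f x ≤ R → ∃ g : G, g • x ∈ L := by
  have : LocallyCompactSpace M := ChartedSpace.locallyCompactSpace E M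
  obtain ⟨q⟩ : Nonempty (MulAction.orbitRel.Quotient G M) := inferInstance
  obtain ⟨x₀, -⟩ := Quotient.exists_rep q
  let d : M → ENNReal := fun x => Metric.infEDist x (MulAction.orbit G x₀)
  have hdle : ∀ (g : G) x, d (g • x) ≤ d x := fun g x => by
    refine le_iInf₂ fun y hy => (iInf₂_le (g • y) ?_).trans (hdist g x y)
    obtain ⟨k, rfl⟩ := hy
    exact ⟨g * k, mul_smul g k x₀⟩
  have hdinv : ∀ (g : G) x, d (g • x) = d x := fun g x =>
    (hdle g x).antisymm (by simpa using hdle g⁻¹ (g • x))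
  have htri : ∀ x y, d x ≤ d y + edist x y := fun x y => Metric.infEDist_le_infEDist_add_edist
  -- `M` may be disconnected, with infinite distances between components. The set where `d` is
  -- infinite is invariant, open and closed, and misses `x₀`, so connectedness of the orbit space
  -- makes it empty.
  have hfin : ∀ x, d x ≠ ⊤ := by
    classical
    have hne : ∀ {x y}, edist x y < ⊤ → d y ≠ ⊤ → d x ≠ ⊤ := fun {x y} h1 h2 =>
      ((htri x y).trans_lt (ENNReal.add_lt_top.2 ⟨h2.lt_top, h1⟩)).ne
    have hcont : Continuous fun x => if d x = ⊤ then (0 : ℝ) else 1 := by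
      rw [continuous_iff_continuousAt]
      intro x
      refine continuousAt_const.congr (f := fun _ => if d x = ⊤ then (0 : ℝ) else 1) ?_
      filter_upwards [Metric.eball_mem_nhds x zero_lt_one] with y hy
      have hy' : edist y x < ⊤ := (Metric.mem_eball.1 hy).trans_le le_top
      have : d x = ⊤ ↔ d y = ⊤ := by
        constructor
        · exact fun h => by_contra fun h' => hne (by rwa [edist_comm]) h' h
        · exact fun h => by_contra fun h' => hne hy' h' h
      simp only [this]
    obtain ⟨c, hc⟩ := exists_eq_const_of_integer_valued (G := G) hcont
      (fun g x => by simp only [hdinv]) fun x => by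
        split_ifs
        exacts [⟨0, by simp⟩, ⟨1, by simp⟩]
    have h0 : d x₀ = 0 := Metric.infEDist_zero_of_mem (MulAction.mem_orbit_self x₀)
    have hc0 := hc x₀
    rw [h0, if_neg (by simp)] at hc0
    intro x hx
    have := hc x
    rw [if_pos hx, ← hc0] at this
    exact zero_ne_one this
  refine ⟨fun x => (d x).toReal, ?_, fun _ => ENNReal.toReal_nonneg,
    fun g x => by simp only [hdinv], fun R => ?_⟩
  · intro x y
    rw [ENNReal.coe_one, one_mul]
    rcases eq_or_ne (edist x y) ⊤ with htop | htop
    · exact htop ▸ le_top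
    have hle : ∀ {x y}, edist x y ≠ ⊤ → (d x).toReal ≤ (d y).toReal + (edist x y).toReal :=
      fun {x y} h => ENNReal.toReal_le_add (htri x y) (hfin y) h
    rw [edist_dist, ENNReal.ofReal_le_iff_le_toReal htop, Real.dist_eq, abs_sub_le_iff]
    have h1 := hle htop
    have h2 := hle (x := y) (y := x) (by rwa [edist_comm])
    rw [edist_comm] at h2
    constructor <;> linarith
  -- The extra 1 makes the inequality strict, so some orbit point realizes it; moving that point to
  -- `x₀` brings `x` into the ball.
  · refine ⟨_, isCompact_closedEBall_of_complete E x₀ (R.toNNReal + 1), fun x hx => ?_⟩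
    have hx1 : d x < ((R.toNNReal + 1 : NNReal) : ENNReal) := by
      rw [← ENNReal.ofReal_toReal (hfin x), ENNReal.ofReal, ENNReal.coe_lt_coe]
      exact (Real.toNNReal_le_toNNReal hx).trans_lt (lt_add_one _)
    obtain ⟨y, ⟨g, rfl⟩, hy⟩ := Metric.infEDist_lt_iff.1 hx1
    refine ⟨g⁻¹, ?_⟩
    have h2 := hdist g⁻¹ (g • x₀) x
    rw [inv_smul_smul, edist_comm (g • x₀)] at h2
    exact h2.trans hy.le

/-- The image of `K` lies in that of `L`, which is compact, hence closed, because the orbit space of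
a proper action is Hausdorff. -/
theorem isCocompact_of_forall_exists_smul_mem [ProperSMul G M] {K L : Set M} (hL : IsCompact L)
    (h : ∀ x ∈ K, ∃ g : G, g • x ∈ L) : IsCocompact G K := by
  have hc := hL.image (f := (Quotient.mk (MulAction.orbitRel G M) :
    M → MulAction.orbitRel.Quotient G M)) continuous_quotient_mk'
  have : T2Space (MulAction.orbitRel.Quotient G M) := t2Space_quotient_mulAction_of_properSMul
  refine hc.closure_of_subset ?_
  rintro _ ⟨x, hx, rfl⟩
  obtain ⟨g, hg⟩ := h x hx
  exact ⟨g • x, hg, Quotient.sound ⟨g, rfl⟩⟩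

theorem compactSpace_of_isCocompact_univ (h : IsCocompact G (univ : Set M)) :
    CompactSpace (MulAction.orbitRel.Quotient G M) := by
  unfold IsCocompact at h
  rw [image_univ, Quotient.mk_surjective.range_eq, closure_univ] at h
  exact ⟨h⟩

end exhaustion

end Higson
end

/-! ### Steps along the levels and the harmonic sum. -/

noncomputable section

namespace Higson

theorem exists_abs_deriv_smoothTransition_le :
    ∃ B : ℝ, 0 ≤ B ∧ ∀ t, |deriv Real.smoothTransition t| ≤ B := by
  have hc : Continuous (deriv Real.smoothTransition) :=
    Real.smoothTransition.contDiff.continuous_deriv (n := 1) le_rfl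
  obtain ⟨B, hB⟩ := (isCompact_Icc (a := (0 : ℝ)) (b := 1)).exists_bound_of_continuousOn
    hc.continuousOn
  have hB0 : 0 ≤ B := (norm_nonneg _).trans (hB 0 (by simp))
  refine ⟨B, hB0, fun t => ?_⟩
  rcases lt_or_ge t 0 with h0 | h0
  · have : Real.smoothTransition =ᶠ[nhds t] fun _ => 0 := by
      filter_upwards [gt_mem_nhds h0] with s hs using Real.smoothTransition.zero_of_nonpos hs.le
    rw [this.deriv_eq, deriv_const, abs_zero]
    exact hB0
  rcases lt_or_ge 1 t with h1 | h1
  · have : Real.smoothTransition =ᶠ[nhds t] fun _ => 1 := by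
      filter_upwards [lt_mem_nhds h1] with s hs using Real.smoothTransition.one_of_one_le hs.le
    rw [this.deriv_eq, deriv_const, abs_zero]
    exact hB0
  · exact hB t ⟨h0, h1⟩

section slowlyVarying

variable {E : Type*} [NormedAddCommGroup E] [NormedSpace ℝ E]
  {G : Type*} [Group G]
  {M : Type*} [TopologicalSpace M] [ChartedSpace E M]
  [RiemannianBundle (fun x : M => TangentSpace 𝓘(ℝ, E) x)]
  [MulAction G M]

variable (E G) in
/-- A smooth invariant function climbing from `0` to `1` between the levels `a + 1 / 8` and
`a + 7 / 8` of `f`, with differential bounded by `C`. -/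
structure IsStep (f : M → ℝ) (C a : ℝ) (χ : M → ℝ) : Prop where
  smooth : ContMDiff 𝓘(ℝ, E) 𝓘(ℝ, ℝ) ∞ χ
  invariant : ∀ (g : G) x, χ (g • x) = χ x
  nonneg : ∀ x, 0 ≤ χ x
  eq_zero : ∀ x, f x < a + 1 / 8 → χ x = 0
  eq_one : ∀ x, a + 7 / 8 < f x → χ x = 1
  bound : ∀ x w, |vdiff E χ x w| ≤ C * ‖w‖

theorem vdiff_congr {f g : M → ℝ} {x : M} (h : f =ᶠ[nhds x] g) : vdiff E f x = vdiff E g x :=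
  h.mfderiv_eq

/-- Cutting off a smoothing of `f` gives a step. -/
theorem exists_isStep {f F : M → ℝ} {Ω : Set M} {a B : ℝ} (hB : 0 ≤ B)
    (hBT : ∀ t, |deriv Real.smoothTransition t| ≤ B)
    (hf : Continuous f) (hinv : ∀ (g : G) x, f (g • x) = f x)
    (hFinv : ∀ (g : G) x, F (g • x) = F x)
    (hfΩ : ∀ x, f x < a + 2 → x ∈ Ω) (hΩ : IsOpen Ω) (hF : ContMDiffOn 𝓘(ℝ, E) 𝓘(ℝ, ℝ) ∞ F Ω)
    (hFf : ∀ x ∈ Ω, |F x - f x| ≤ 1 / 8) (hFd : ∀ x ∈ Ω, ∀ w, |vdiff E F x w| ≤ 5 * ‖w‖) :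
    ∃ χ, IsStep E G f (10 * B) a χ := by
  classical
  -- `T` rises from 0 at `a + 1/4` to 1 at `a + 3/4`; the error 1/8 between `F` and `f` widens this
  -- to the levels `a + 1/8` and `a + 7/8`. The slope factor 2 and the bound 5 on `dF` give `10 *
  -- B`.
  let T : ℝ → ℝ := fun s => Real.smoothTransition (2 * (s - a - 1 / 4))
  have hT : ContDiff ℝ ∞ T := Real.smoothTransition.contDiff.comp (by fun_prop)
  have hTd : ∀ s, HasDerivAt T (deriv Real.smoothTransition (2 * (s - a - 1 / 4)) * 2) s :=
    fun s => by
    have h1 : HasDerivAt (fun s : ℝ => 2 * (s - a - 1 / 4)) 2 s := by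
      have := (((hasDerivAt_id s).sub_const a).sub_const (1 / 4)).const_mul 2
      rwa [mul_one] at this
    exact HasDerivAt.comp s ((Real.smoothTransition.contDiff (n := 1)).differentiable
      one_ne_zero _).hasDerivAt h1
  -- `F` is controlled only on `Ω`. The two branches agree for `f` between `a + 7/8` and `a + 2`, so
  -- the gluing is smooth.
  let χ : M → ℝ := fun x => if f x < a + 2 then T (F x) else 1
  have hχ0 : ∀ x, f x < a + 1 / 8 → χ x = 0 := fun x hx => by
    have hx2 : f x < a + 2 := by linarith
    simp only [χ, if_pos hx2, T]
    apply Real.smoothTransition.zero_of_nonpos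
    linarith [(abs_le.1 (hFf x (hfΩ x hx2))).2]
  have hχ1 : ∀ x, a + 7 / 8 < f x → χ x = 1 := fun x hx => by
    by_cases hx2 : f x < a + 2
    · simp only [χ, if_pos hx2, T]
      apply Real.smoothTransition.one_of_one_le
      linarith [(abs_le.1 (hFf x (hfΩ x hx2))).1]
    · simp only [χ, if_neg hx2]
  have hloc : ∀ x, f x < a + 2 → χ =ᶠ[nhds x] T ∘ F := fun x hx => by
    filter_upwards [(isOpen_lt hf continuous_const).mem_nhds hx] with y hy
    exact if_pos hy
  have hloc1 : ∀ x, ¬ f x < a + 2 → χ =ᶠ[nhds x] fun _ => 1 := fun x hx => by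
    filter_upwards [(isOpen_lt continuous_const hf).mem_nhds
      (show a + 7 / 8 < f x by linarith)] with y hy
    exact hχ1 y hy
  have hFat : ∀ x, f x < a + 2 → ContMDiffAt 𝓘(ℝ, E) 𝓘(ℝ, ℝ) ∞ F x := fun x hx =>
    hF.contMDiffAt (hΩ.mem_nhds (hfΩ x hx))
  refine ⟨χ, fun x => ?_, fun g x => ?_, fun x => ?_, hχ0, hχ1, fun x w => ?_⟩
  · by_cases hx : f x < a + 2
    · exact (hT.contMDiff.contMDiffAt.comp x (hFat x hx)).congr_of_eventuallyEq (hloc x hx)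
    · exact contMDiffAt_const.congr_of_eventuallyEq (hloc1 x hx)
  · simp only [χ, hinv, hFinv]
  · simp only [χ]
    split_ifs
    exacts [Real.smoothTransition.nonneg _, zero_le_one]
  · by_cases hx : f x < a + 2
    · have h1 := HasMFDerivAt.comp x (hTd (F x)).hasFDerivAt.hasMFDerivAt
        (hasMFDerivAt_vdiff ((hFat x hx).mdifferentiableAt (by simp)))
      rw [vdiff_congr (hloc x hx), vdiff_eq_of_hasMFDerivAt h1]
      change |vdiff E F x w • (deriv Real.smoothTransition (2 * (F x - a - 1 / 4)) * 2)| ≤ _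
      rw [smul_eq_mul, abs_mul, abs_mul, abs_two]
      calc _ ≤ (5 * ‖w‖) * (B * 2) := by
            gcongr
            exacts [hFd x (hfΩ x hx) w, hBT _]
        _ = _ := by ring
    · rw [vdiff_congr (hloc1 x hx), vdiff_const, zero_apply, abs_zero]
      positivity

variable {f : M → ℝ} {C : ℝ} {χ : ℕ → M → ℝ}

/-- Steps along the levels of `f`, with heights the terms of the harmonic series. -/
def stepSum (χ : ℕ → M → ℝ) (x : M) : ℝ := ∑' n : ℕ, χ n x / (n + 1)

/-- Only the step `m` can be in progress. The margin 1/8 below `m` makes the formula hold on an open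
set that includes the level `f x = m`. -/
theorem stepSum_eq (hχ : ∀ n : ℕ, IsStep E G f C n (χ n)) {x : M} {m : ℕ}
    (h1 : (m : ℝ) - 1 / 8 < f x) (h2 : f x < m + 1) :
    stepSum χ x = ∑ n ∈ Finset.range m, 1 / ((n : ℝ) + 1) + χ m x / (m + 1) := by
  rw [stepSum, tsum_eq_sum (s := Finset.range (m + 1)), Finset.sum_range_succ]
  · congr 1
    refine Finset.sum_congr rfl fun n hn => ?_
    rw [(hχ n).eq_one]
    have : (n : ℝ) + 1 ≤ m := by exact_mod_cast Finset.mem_range.1 hn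
    linarith
  · intro n hn
    have : (m : ℝ) + 1 ≤ n := by exact_mod_cast not_lt.1 fun h => hn (Finset.mem_range.2 h)
    rw [(hχ n).eq_zero, zero_div]
    linarith

theorem stepSum_eq_floor (hf0 : ∀ x, 0 ≤ f x) (hχ : ∀ n : ℕ, IsStep E G f C n (χ n)) (x : M) :
    stepSum χ x =
      ∑ n ∈ Finset.range ⌊f x⌋₊, 1 / ((n : ℝ) + 1) + χ ⌊f x⌋₊ x / (⌊f x⌋₊ + 1) :=
  stepSum_eq hχ (by linarith [Nat.floor_le (hf0 x)]) (Nat.lt_floor_add_one _)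

theorem stepSum_eventuallyEq (hf : Continuous f) (hf0 : ∀ x, 0 ≤ f x)
    (hχ : ∀ n : ℕ, IsStep E G f C n (χ n)) (x : M) :
    stepSum χ =ᶠ[nhds x] fun y =>
      ∑ n ∈ Finset.range ⌊f x⌋₊, 1 / ((n : ℝ) + 1) + χ ⌊f x⌋₊ y * (1 / (⌊f x⌋₊ + 1)) := by
  filter_upwards [(isOpen_lt continuous_const hf).mem_nhds
      (show (⌊f x⌋₊ : ℝ) - 1 / 8 < f x by linarith [Nat.floor_le (hf0 x)]),
    (isOpen_lt hf continuous_const).mem_nhds (Nat.lt_floor_add_one (f x))] with y h1 h2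
  rw [stepSum_eq hχ h1 h2, div_eq_mul_one_div (χ _ y)]

/-- A sum of steps of harmonic heights is slowly varying. -/
theorem slowlyVarying_stepSum (hf : Continuous f) (hf0 : ∀ x, 0 ≤ f x)
    (hcoc : ∀ R, IsCocompact G {x | f x ≤ R}) (hC : 0 ≤ C)
    (hχ : ∀ n : ℕ, IsStep E G f C n (χ n)) : SlowlyVarying E G (stepSum χ) where
  smooth x := by
    refine ContMDiffAt.congr_of_eventuallyEq ?_ (stepSum_eventuallyEq hf hf0 hχ x)
    exact contMDiffAt_const.add ((hχ _).smooth.contMDiffAt.mul contMDiffAt_const)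
  invariant g x := by simp only [stepSum, (hχ _).invariant]
  vanishes ε hε := by
    -- Above level `m` the only active step has index `k ≥ m`, so the differential is at most `C /
    -- (k + 1) < ε`.
    obtain ⟨m, hm⟩ := exists_nat_gt (C / ε)
    refine ⟨_, hcoc m, fun x hx w => ?_⟩
    have hx : (m : ℝ) < f x := not_le.1 hx
    set k := ⌊f x⌋₊ with hk
    have hmk : (m : ℝ) ≤ k := by exact_mod_cast Nat.le_floor hx.le
    have h1 := ((hasMFDerivAt_const (I := 𝓘(ℝ, E)) (I' := 𝓘(ℝ, ℝ))
      (∑ n ∈ Finset.range k, 1 / ((n : ℝ) + 1)) x).add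
      ((hasMFDerivAt_vdiff ((hχ k).smooth.mdifferentiable (by simp) x)).mul
        (hasMFDerivAt_const (I := 𝓘(ℝ, E)) (I' := 𝓘(ℝ, ℝ)) (1 / ((k : ℝ) + 1)) x)))
    have h2 : vdiff E (stepSum χ) x w = 1 / ((k : ℝ) + 1) * vdiff E (χ k) x w := by
      rw [vdiff_congr (stepSum_eventuallyEq hf hf0 hχ x)]
      refine (DFunLike.congr_fun (vdiff_eq_of_hasMFDerivAt h1) w).trans ?_
      change 0 + (χ k x * 0 + 1 / ((k : ℝ) + 1) * vdiff E (χ k) x w) = _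
      rw [mul_zero, zero_add, zero_add]
    rw [h2, abs_mul, abs_of_pos (by positivity)]
    calc _ ≤ 1 / ((k : ℝ) + 1) * (C * ‖w‖) := by
          gcongr
          exact (hχ k).bound x w
      _ = C / (k + 1) * ‖w‖ := by ring
      _ ≤ ε * ‖w‖ := by
          gcongr
          rw [div_le_iff₀ (by positivity)]
          rw [div_lt_iff₀ hε] at hm
          nlinarith

theorem exists_lt_stepSum (hf0 : ∀ x, 0 ≤ f x) (hunb : ∀ R, ∃ x, R < f x)
    (hχ : ∀ n : ℕ, IsStep E G f C n (χ n)) (R : ℝ) : ∃ x, R < stepSum χ x := by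
  obtain ⟨m, hm⟩ := (Real.tendsto_sum_range_one_div_nat_succ_atTop.eventually_gt_atTop R).exists
  obtain ⟨x, hx⟩ := hunb m
  refine ⟨x, hm.trans_le ?_⟩
  rw [stepSum_eq_floor hf0 hχ]
  have h1 : 0 ≤ χ ⌊f x⌋₊ x / ((⌊f x⌋₊ : ℝ) + 1) := div_nonneg ((hχ _).nonneg x) (by positivity)
  refine le_add_of_le_of_nonneg ?_ h1
  exact Finset.sum_le_sum_of_subset_of_nonneg
    (Finset.range_subset_range.2 (Nat.le_floor hx.le)) fun n _ _ => by positivity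

end slowlyVarying

end Higson
end

/-! ### Assembly of the exhaustion, the steps and the embedding. -/

theorem mainTheorem9
    -- a Lie group `G`
    {E' : Type*} [NormedAddCommGroup E'] [NormedSpace ℝ E'] [FiniteDimensional ℝ E']
    (G : Type*) [TopologicalSpace G] [T2Space G] [ChartedSpace E' G] [Group G]
    [LieGroup 𝓘(ℝ, E') ∞ G]
    -- a complete Riemannian manifold `M`
    {E : Type*} [NormedAddCommGroup E] [NormedSpace ℝ E] [FiniteDimensional ℝ E]
    (M : Type*) [EMetricSpace M] [SecondCountableTopology M] [ChartedSpace E M]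
    [IsManifold 𝓘(ℝ, E) ∞ M]
    [RiemannianBundle (fun x : M => TangentSpace 𝓘(ℝ, E) x)]
    [IsContMDiffRiemannianBundle 𝓘(ℝ, E) ∞ E (fun x : M => TangentSpace 𝓘(ℝ, E) x)]
    [IsRiemannianManifold 𝓘(ℝ, E) M] [CompleteSpace M]
    -- a smooth, proper, isometric action with connected, non-compact orbit space
    [MulAction G M] [ContMDiffSMul 𝓘(ℝ, E') 𝓘(ℝ, E) ∞ G M] [ProperSMul G M]
    (hisom : ∀ (g : G) (x : M) (v : TangentSpace 𝓘(ℝ, E) x),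
      ‖mfderiv 𝓘(ℝ, E) 𝓘(ℝ, E) (fun y : M => g • y) x v‖ = ‖v‖)
    (hconn : ConnectedSpace (MulAction.orbitRel.Quotient G M))
    (hnoncocompact : ¬ CompactSpace (MulAction.orbitRel.Quotient G M)) :
    ∃ S : AddSubgroup (Cech.H1 (Higson.Compactification E G M)), Nonempty (S ≃+ ℝ) := by
  have : IsTopologicalGroup G := topologicalGroup_of_lieGroup 𝓘(ℝ, E') ∞
  have : LocallyCompactSpace G := ChartedSpace.locallyCompactSpace E' G
  obtain ⟨f, hf, hf0, hinv, hL⟩ := Higson.exists_invariant_lipschitz_exhaustion (G := G) (E := E)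
    (fun g => Higson.edist_smul_smul_le (Higson.contMDiff_const_smul' E' g) (hisom g))
  have hcoc : ∀ R, Higson.IsCocompact G {x | f x ≤ R} := fun R => by
    obtain ⟨L, hLc, hL⟩ := hL R
    exact Higson.isCocompact_of_forall_exists_smul_mem hLc hL
  have hunb : ∀ R, ∃ x, R < f x := fun R => by
    by_contra! hle
    refine hnoncocompact (Higson.compactSpace_of_isCocompact_univ ?_)
    convert hcoc R
    exact (Set.eq_univ_of_forall hle).symm
  obtain ⟨B, hB, hBT⟩ := Higson.exists_abs_deriv_smoothTransition_le
  have hstep : ∀ n : ℕ, ∃ χ, Higson.IsStep E G f (10 * B) n χ := fun n => by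
    -- The cutoff needs a smoothing wherever `f x < n + 2`. Each such orbit meets `L`, and the
    -- domain of the smoothing is invariant and contains `L`.
    obtain ⟨L, hLc, hL⟩ := hL (n + 2)
    obtain ⟨Ω, F, hΩ, hΩinv, hLΩ, hFinv, hF, hFf⟩ := Higson.exists_invariant_smoothing E' hisom hf
      hinv hLc (δ := 1 / 8) (by norm_num)
    refine Higson.exists_isStep hB hBT hf.continuous hinv hFinv (fun x hx => ?_) hΩ hF
      (fun x hx => (hFf x hx).1) fun x hx => (hFf x hx).2
    obtain ⟨g, hg⟩ := hL x hx.le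
    simpa using hΩinv g⁻¹ _ (hLΩ hg)
  choose χ hχ using hstep
  exact Higson.exists_addSubgroup_of_slowlyVarying
    (Higson.slowlyVarying_stepSum hf.continuous hf0 hcoc (by positivity) hχ)
    (Higson.exists_lt_stepSum hf0 hunb hχ)
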